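/- Let $d \ge 0$ be an integer and let $0 < \beta < \beta_c(d)$, where $\beta_c(d)$ is the solution of $(d-1)\tanh \beta_c(d) = 1$ if $d \ge 3$, and $\beta_c(d) = \infty$ if $d \le 2$. For a finite simple graph $G=(V,E)$ let $\mu_{G,\beta}$ be the Ising Gibbs distribution on $\{+1,-1\}^V$, $\mu_{G,\beta}(\sigma) \propto \exp\big(\beta \sum_{\{u,v\}\in E} \sigma(u)\sigma(v)\big)$. One step of the Isolated-vertex dynamics from a configuration $\sigma$ is as follows: keep each edge $\{u,v\}\in E$ with $\sigma(u)=\sigma(v)$ independently with probability $1-e^{-2\beta}$ and drop all other edges, which gives a set $F \subseteq E$; then assign independent uniform random spins to the isolated vertices of $(V,F)$, while all other vertices keep their spin. There are constants $c, C > 0$, depending only on $d$ and $\beta$, such that for every graph $G$ with $n \ge 1$ vertices and maximum degree at most $d$ the Isolated-vertex dynamics $P$ is ergodic (irreducible and aperiodic) and reversible with respect to $\mu_{G,\beta}$, and the following hold. 1. If $n \ge 2$, the mixing time $T_{\mathrm{mix}}(P) = \max_{\sigma}\min\{t \ge 0 : \|P^t(\sigma,\cdot)-\mu_{G,\beta}\|_{\mathrm{TV}}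 \le 1/4\}$ satisfies $T_{\mathrm{mix}}(P) \le C \log n$. 2. The relaxation time $T_{\mathrm{rel}}(P) = 1/(1-\lambda^*)$, where $\lambda^*$ is the largest absolute value of an eigenvalue of $P$ other than the simple eigenvalue $1$, satisfies $c \le T_{\mathrm{rel}}(P) \le C$. -/

import Mathlib

open scoped ENNReal

/-- The threshold `β_c(d)`: the solution `b` of `(d - 1) * tanh b = 1`.
It is unique if it exists, and it exists exactly for `d ≥ 3`;
for `d ≤ 2` the infimum is over the empty set and the value is `⊤`. -/
noncomputable def criticalBeta (d : ℕ) : EReal :=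
  sInf ((fun b : ℝ => (b : EReal)) '' {b : ℝ | ((d : ℝ) - 1) * Real.tanh b = 1})

namespace FiniteChain

variable {S : Type*} [Fintype S] [DecidableEq S]

/-- `P` is the transition matrix of an irreducible and aperiodic Markov chain. -/
def IsErgodic (P : Matrix S S ℝ) : Prop :=
  P ∈ Matrix.rowStochastic ℝ S ∧
  (∀ x y, ∃ t : ℕ, 0 < (P ^ t) x y) ∧
  (∀ x, ∀ k : ℕ, (∀ t : ℕ, 0 < t → 0 < (P ^ t) x x → k ∣ t) → k = 1)

/-- Detailed balance of `P` with respect to `π`. -/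
def IsReversible (P : Matrix S S ℝ) (π : S → ℝ) : Prop :=
  ∀ x y, π x * P x y = π y * P y x

/-- Total variation distance of two probability vectors. -/
noncomputable def tvDist (p q : S → ℝ) : ℝ := (1 / 2) * ∑ x, |p x - q x|

/-- `max_x min {t ≥ 0 : ‖P^t(x, ·) - π‖_TV ≤ ε}`; a minimum over the empty set is `⊤`. -/
noncomputable def mixingTimeAt (P : Matrix S S ℝ) (π : S → ℝ) (ε : ℝ) : ℕ∞ :=
  ⨆ x : S, ⨅ t ∈ {t : ℕ | tvDist ((P ^ t) x) π ≤ ε}, (t : ℕ∞)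

/-- The mixing time, with the threshold `1/4`. -/
noncomputable def mixingTime (P : Matrix S S ℝ) (π : S → ℝ) : ℕ∞ :=
  mixingTimeAt P π (1 / 4)

/-- The absolute spectral gap `1 - λ*`, where `λ*` is the largest absolute value of an
eigenvalue different from `1`. (For ergodic reversible chains all eigenvalues are real and
`1` is a simple eigenvalue.) -/
noncomputable def absSpectralGap (P : Matrix S S ℝ) : ℝ :=
  1 - sSup {a : ℝ | ∃ l : ℝ, Module.End.HasEigenvalue (Matrix.toLin' P) l ∧ l ≠ 1 ∧ a = |l|}

/-- The relaxation time: the inverse of the absolute spectral gap. -/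
noncomputable def relaxationTime (P : Matrix S S ℝ) : ℝ := (absSpectralGap P)⁻¹

end FiniteChain

namespace Ising

variable {V : Type*} [Fintype V] [DecidableEq V] (G : SimpleGraph V) [DecidableRel G.Adj]

/-- The numerical value of a spin: `true` is `+1` and `false` is `-1`. -/
def spin (b : Bool) : ℝ := if b then 1 else -1

/-- The weight `exp (β ∑_{{u,v} ∈ E} σ(u) σ(v))`. -/
noncomputable def weight (β : ℝ) (σ : V → Bool) : ℝ :=
  Real.exp (β * ∑ e ∈ G.edgeFinset, (e.map fun v => spin (σ v)).mul)

/-- The partition function. -/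
noncomputable def partitionFunction (β : ℝ) : ℝ := ∑ σ : V → Bool, weight G β σ

/-- The Gibbs distribution of the Ising model. -/
noncomputable def gibbs (β : ℝ) (σ : V → Bool) : ℝ :=
  weight G β σ / partitionFunction G β

/-- The set of edges of `G` whose two endpoints have the same spin in `σ`. -/
def agreeingEdges (σ : V → Bool) : Finset (Sym2 V) :=
  G.edgeFinset.filter fun e => (e.map σ).IsDiag

/-- The vertex `v` is isolated in the subgraph `(V, F)`. -/
def IsIsolatedIn (F : Finset (Sym2 V)) (v : V) : Prop := ∀ e ∈ F, v ∉ e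

instance (F : Finset (Sym2 V)) (v : V) : Decidable (IsIsolatedIn F v) :=
  inferInstanceAs (Decidable (∀ e ∈ F, v ∉ e))

/-- The probability that independent percolation on the agreeing edges of `σ`, where each edge
is kept with probability `1 - exp (-2β)`, results in the edge set `F`. -/
noncomputable def percolationProb (β : ℝ) (σ : V → Bool) (F : Finset (Sym2 V)) : ℝ :=
  (1 - Real.exp (-2 * β)) ^ F.card * Real.exp (-2 * β) ^ (agreeingEdges G σ \ F).card

/-- The probability of passing from `σ` to `τ` when every isolated vertex of `(V, F)` receives
an independent uniform spin and all other vertices keep their spin. -/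
noncomputable def resampleProb (F : Finset (Sym2 V)) (σ τ : V → Bool) : ℝ :=
  ∏ v, if IsIsolatedIn F v then (1 / 2 : ℝ) else if τ v = σ v then 1 else 0

/-- The transition matrix of the Isolated-vertex dynamics. -/
noncomputable def isolatedVertexDynamics (β : ℝ) : Matrix (V → Bool) (V → Bool) ℝ :=
  fun σ τ => ∑ F ∈ (agreeingEdges G σ).powerset, percolationProb G β σ F * resampleProb F σ τ

end Ising

set_option linter.unusedSectionVars false

/-! The proof combines monotonicity, censoring and decay of correlations on balls.

Sampling a Bernoulli percolation on all edges, independently of the spins, gives one step of the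
dynamics: a vertex is resampled when it has no open edge to a neighbour of equal spin. This couples
all starting points and preserves their order (`localDynamics_mono`). In the Edwards–Sokal joint
weight, the isolated vertices carry independent uniform spins given the open edges; averaging over
more of them can only lower correlations of increasing functions. Hence forbidding updates outside a
set `A` keeps the chains from all-plus and all-minus further apart (`localDynamics_pow_add_top_le`,
`localDynamics_pow_add_bot_ge`).

Take `A` to be a ball of radius `R` around `v`. After `T` censored steps the ball is nearly in
equilibrium given its boundary, since each step resamples the whole ball with probability bounded
below. The effect of a boundary spin on `v` in equilibrium is at most twice the sum of `tanh β ^ k`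
over non-backtracking walks of length `k` (`blockMean_update_sub_le`). Summed over `v` this is a
tail of a geometric series of ratio `(d - 1) tanh β < 1`. So for suitable `R`, then `T`, depending
only on `d` and `β`, the total sensitivity to any one spin is at most `1`, and the sum over `v` of
the gaps between the expected spins from all-plus and all-minus halves every `T` steps
(`sum_spinGap_add_le`).

The summed gap starts at `2n` and controls the oscillation of every observable, not only monotone
ones (`localDynamics_pow_univ_sub_le`). This gives mixing in `O(log n)` steps; applied to
eigenvectors over arbitrarily long times, it bounds `|λ| ^ T` by `1/2` with no trace of `n`. -/

namespace Ising

/-! ### Uniform resampling and association of increasing functions -/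

section Resampling

variable {V : Type*} [Fintype V] [DecidableEq V]

/-- Replace the spins of `σ` in `S` by those of `s`. -/
def resample (S : Finset V) (s σ : V → Bool) : V → Bool := fun v => if v ∈ S then s v else σ v

/-- The expectation of `f` after assigning independent uniform spins to the vertices in `S`. -/
noncomputable def avg (S : Finset V) (f : (V → Bool) → ℝ) (σ : V → Bool) : ℝ :=
  (∑ s : V → Bool, f (resample S s σ)) / 2 ^ Fintype.card V

/-- Exchange the restrictions to `S` of two configurations. -/
def swapOn (S : Finset V) : Equiv.Perm ((V → Bool) × (V → Bool)) :=
  Function.Involutive.toPerm (fun p => (resample S p.2 p.1, resample S p.1 p.2)) (by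
    rintro ⟨s, t⟩
    ext v <;> by_cases h : v ∈ S <;> simp [resample, h])

lemma swapOn_apply (S : Finset V) (s t : V → Bool) :
    swapOn S (s, t) = (resample S t s, resample S s t) := rfl

lemma resample_resample (S T : Finset V) (s t σ : V → Bool) :
    resample T t (resample S s σ) = resample (S ∪ T) (resample T t s) σ := by
  ext v; by_cases h : v ∈ T <;> by_cases h' : v ∈ S <;> simp [resample, h, h']

lemma resample_mono (S : Finset V) (s : V → Bool) : Monotone (resample S s) := by
  intro σ τ h v
  by_cases hv : v ∈ S <;> simp [resample, hv, h v]

@[simp] lemma resample_empty (s σ : V → Bool) : resample ∅ s σ = σ := by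
  ext v; simp [resample]

lemma sum_swapOn (S : Finset V) (h : (V → Bool) → (V → Bool) → ℝ) :
    ∑ s, ∑ t, h (resample S t s) (resample S s t) = ∑ s, ∑ t, h s t := by
  have := Equiv.sum_comp (swapOn S) (fun p : (V → Bool) × (V → Bool) => h p.1 p.2)
  simpa only [Fintype.sum_prod_type, swapOn_apply] using this

/-- The combined fresh spins are again uniform, because exchanging coordinates of two independent
uniform configurations preserves their joint law. -/
lemma avg_avg (S T : Finset V) (f : (V → Bool) → ℝ) : avg S (avg T f) = avg (S ∪ T) f := by
  ext σ
  have h2 : (2 : ℝ) ^ Fintype.card V ≠ 0 := by positivity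
  have := sum_swapOn T (fun s _ : V → Bool => f (resample (S ∪ T) s σ))
  simp only [Finset.sum_const, Finset.card_univ, Fintype.card_pi, Fintype.card_bool,
    Finset.prod_const, nsmul_eq_mul, Nat.cast_pow, Nat.cast_ofNat] at this
  simp only [avg, resample_resample, ← Finset.sum_div]
  rw [this, ← Finset.mul_sum]
  field_simp

lemma avg_empty (f : (V → Bool) → ℝ) : avg ∅ f = f := by
  ext σ; simp [avg]

lemma avg_mono {f : (V → Bool) → ℝ} (hf : Monotone f) (S : Finset V) : Monotone (avg S f) := by
  intro σ τ h
  unfold avg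
  gcongr with s
  exact hf (resample_mono S s h)

lemma avg_add (S : Finset V) (f g : (V → Bool) → ℝ) (σ : V → Bool) :
    avg S (f + g) σ = avg S f σ + avg S g σ := by
  simp [avg, Finset.sum_add_distrib, add_div]

lemma avg_smul (S : Finset V) (a : ℝ) (f : (V → Bool) → ℝ) (σ : V → Bool) :
    avg S (a • f) σ = a * avg S f σ := by
  simp [avg, ← Finset.mul_sum, mul_div_assoc]

lemma avg_eq_of_const {S : Finset V} {f : (V → Bool) → ℝ} {σ : V → Bool} {c : ℝ}
    (h : ∀ s, f (resample S s σ) = c) : avg S f σ = c := by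
  simp [avg, h]

lemma avg_le_avg {S : Finset V} {f g : (V → Bool) → ℝ} {σ : V → Bool}
    (h : ∀ s, f (resample S s σ) ≤ g (resample S s σ)) : avg S f σ ≤ avg S g σ := by
  unfold avg
  gcongr with s
  exact h s

lemma avg_pos {S : Finset V} {f : (V → Bool) → ℝ} (h : ∀ σ, 0 < f σ) (σ : V → Bool) :
    0 < avg S f σ := by
  unfold avg
  exact div_pos (Finset.sum_pos (fun s _ => h _) Finset.univ_nonempty) (by positivity)

lemma avg_congr {S : Finset V} {f g : (V → Bool) → ℝ} {σ τ : V → Bool}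
    (h : ∀ s, f (resample S s σ) = g (resample S s τ)) : avg S f σ = avg S g τ := by
  simp [avg, h]

/-- A weight `c` blind to the spins in `S` makes the old and the fresh spins there exchangeable, so
`avg S` is self-adjoint. -/
lemma sum_mul_avg_symm {S : Finset V} {c : (V → Bool) → ℝ}
    (hc : ∀ s σ, c (resample S s σ) = c σ) (f g : (V → Bool) → ℝ) :
    ∑ σ, c σ * avg S f σ * g σ = ∑ σ, c σ * f σ * avg S g σ := by
  have := sum_swapOn S (fun σ s => c σ * f σ * g (resample S s σ) / 2 ^ Fintype.card V)
  have h1 : ∀ σ s : V → Bool, resample S (resample S σ s) (resample S s σ) = σ := by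
    intro σ s; ext v; by_cases h : v ∈ S <;> simp [resample, h]
  simp only [h1, hc] at this
  simp only [avg, Finset.sum_div, Finset.mul_sum, Finset.sum_mul]
  convert this using 4 <;> ring

/-- Chebyshev's association inequality at one site: `σ` and its resampled version differ only at
`v`, hence are comparable, and the increments of `f` and `g` between them have the same sign. -/
lemma sum_mul_avg_singleton_le {v : V} {c : (V → Bool) → ℝ} (hc0 : ∀ σ, 0 ≤ c σ)
    (hc : ∀ s σ, c (resample {v} s σ) = c σ) {f g : (V → Bool) → ℝ}
    (hf : Monotone f) (hg : Monotone g) :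
    ∑ σ, c σ * avg {v} f σ * g σ ≤ ∑ σ, c σ * f σ * g σ := by
  have key : ∑ σ, ∑ s, c σ * (f σ - f (resample {v} s σ)) * g σ =
      ∑ σ, ∑ s, c σ * (f (resample {v} s σ) - f σ) * g (resample {v} s σ) := by
    rw [← sum_swapOn {v}]
    have h1 : ∀ σ s : V → Bool, resample {v} (resample {v} σ s) (resample {v} s σ) = σ := by
      intro σ s; ext w; by_cases h : w = v <;> simp [resample, h]
    simp only [h1, hc]
  have pos : 0 ≤ ∑ σ : V → Bool, ∑ s, c σ * (f σ - f (resample {v} s σ)) *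
      (g σ - g (resample {v} s σ)) := by
    refine Finset.sum_nonneg fun σ _ => Finset.sum_nonneg fun s _ => ?_
    rw [mul_assoc]
    refine mul_nonneg (hc0 σ) ?_
    rcases le_total (s v) (σ v) with h | h
    · have : resample {v} s σ ≤ σ := by
        intro w; by_cases hw : w = v
        · subst hw; simpa [resample] using h
        · simp [resample, hw]
      exact mul_nonneg (sub_nonneg.2 (hf this)) (sub_nonneg.2 (hg this))
    · have : σ ≤ resample {v} s σ := by
        intro w; by_cases hw : w = v
        · subst hw; simpa [resample] using h
        · simp [resample, hw]
      exact mul_nonneg_of_nonpos_of_nonpos (sub_nonpos.2 (hf this)) (sub_nonpos.2 (hg this))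
  have split : ∑ σ : V → Bool, ∑ s, c σ * (f σ - f (resample {v} s σ)) *
      (g σ - g (resample {v} s σ)) = ∑ σ, ∑ s, c σ * (f σ - f (resample {v} s σ)) * g σ +
      ∑ σ, ∑ s, c σ * (f (resample {v} s σ) - f σ) * g (resample {v} s σ) := by
    simp only [← Finset.sum_add_distrib]
    refine Finset.sum_congr rfl fun σ _ => Finset.sum_congr rfl fun s _ => ?_
    ring
  have h0 : 0 ≤ ∑ σ : V → Bool, ∑ s, c σ * (f σ - f (resample {v} s σ)) * g σ := by linarith
  have h2 : (0 : ℝ) < 2 ^ Fintype.card V := by positivity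
  have h3 : ∑ σ : V → Bool, ∑ s, c σ * (f σ - f (resample {v} s σ)) * g σ =
      2 ^ Fintype.card V * (∑ σ, c σ * f σ * g σ - ∑ σ, c σ * avg {v} f σ * g σ) := by
    rw [← Finset.sum_sub_distrib, Finset.mul_sum]
    refine Finset.sum_congr rfl fun σ _ => ?_
    simp only [avg, mul_sub, sub_mul, Finset.sum_sub_distrib, Finset.sum_const, Finset.card_univ,
      Fintype.card_pi, Fintype.card_bool, Finset.prod_const, nsmul_eq_mul, Nat.cast_pow,
      Nat.cast_ofNat, ← Finset.mul_sum, ← Finset.sum_mul]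
    field_simp
  rw [h3] at h0
  exact sub_nonneg.1 (nonneg_of_mul_nonneg_right h0 h2)

lemma sum_mul_avg_le {S : Finset V} {c : (V → Bool) → ℝ} (hc0 : ∀ σ, 0 ≤ c σ)
    (hc : ∀ v ∈ S, ∀ s σ, c (resample {v} s σ) = c σ) {f g : (V → Bool) → ℝ}
    (hf : Monotone f) (hg : Monotone g) :
    ∑ σ, c σ * avg S f σ * g σ ≤ ∑ σ, c σ * f σ * g σ := by
  induction S using Finset.induction_on with
  | empty => simp [avg_empty]
  | insert v S _ ih =>
    rw [show insert v S = {v} ∪ S from rfl, ← avg_avg]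
    exact (sum_mul_avg_singleton_le hc0 (hc v (by simp)) (avg_mono hf S) hg).trans
      (ih fun w hw => hc w (by simp [hw]))

lemma sum_resampleProb_mul (F : Finset (Sym2 V)) (σ : V → Bool) (f : (V → Bool) → ℝ) :
    ∑ τ, resampleProb F σ τ * f τ = avg (Finset.univ.filter (IsIsolatedIn F)) f σ := by
  set S := Finset.univ.filter (IsIsolatedIn F) with hS
  have h1 : ∀ τ, resampleProb F σ τ =
      (∑ s : V → Bool, if resample S s σ = τ then (1 : ℝ) else 0) / 2 ^ Fintype.card V := by
    intro τ
    -- Both the indicator and the factor `2 ^ (-|V|)` factorize over vertices, so the sum over `s`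
    -- becomes a product of two-term sums.
    have h2 : ∀ s : V → Bool, (if resample S s σ = τ then (1 : ℝ) else 0) / 2 ^ Fintype.card V =
        ∏ v, (if (if v ∈ S then s v else σ v) = τ v then (1 / 2 : ℝ) else 0) := by
      intro s
      by_cases h : resample S s σ = τ
      · have : ∀ v, (if v ∈ S then s v else σ v) = τ v := fun v => congrFun h v
        simp [h, this]
      · rw [if_neg h]
        obtain ⟨v, hv⟩ : ∃ v, resample S s σ v ≠ τ v := by
          by_contra! h'; exact h (funext h')
        rw [Finset.prod_eq_zero (Finset.mem_univ v)]
        · simp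
        · rw [if_neg]; exact hv
    simp only [Finset.sum_div, h2]
    rw [← Fintype.prod_sum (fun v (b : Bool) =>
      if (if v ∈ S then b else σ v) = τ v then (1 / 2 : ℝ) else 0)]
    unfold resampleProb
    refine Finset.prod_congr rfl fun v _ => ?_
    by_cases hv : IsIsolatedIn F v
    · have : v ∈ S := by simp [hS, hv]
      cases h : τ v <;> simp [hv, this]
    · have : v ∉ S := by simp [hS, hv]
      by_cases h : σ v = τ v
      · simp [hv, this, h]
      · simp [hv, this, h, Ne.symm h]
  simp only [h1, avg, Finset.sum_div, Finset.sum_mul]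
  rw [Finset.sum_comm]
  refine Finset.sum_congr rfl fun s _ => ?_
  rw [Finset.sum_eq_single (resample S s σ)]
  · simp; ring
  · intro τ _ h; simp [Ne.symm h]
  · simp

end Resampling

end Ising

/-- The trace on `B` of Bernoulli percolation on `E` is Bernoulli percolation on `B`: the states of
the edges in `E \ B` sum out to `1`. -/
lemma Finset.sum_powerset_inter_eq {α : Type*} [DecidableEq α] (p : ℝ) {E B F : Finset α}
    (hB : B ⊆ E) (hF : F ⊆ B) :
    ∑ ω ∈ E.powerset with ω ∩ B = F, (1 - p) ^ ω.card * p ^ (E \ ω).card =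
      (1 - p) ^ F.card * p ^ (B \ F).card := by
  have h1 : ∑ ω ∈ E.powerset with ω ∩ B = F, (1 - p) ^ ω.card * p ^ (E \ ω).card =
      ∑ ω ∈ (E \ B).powerset, ((1 - p) ^ F.card * p ^ (B \ F).card) *
        ((1 - p) ^ ω.card * p ^ ((E \ B).card - ω.card)) := by
    refine Finset.sum_nbij' (fun ω => ω \ B) (fun ω => F ∪ ω) ?_ ?_ ?_ ?_ ?_
    · intro ω h
      simp only [Finset.mem_filter, Finset.mem_powerset] at h ⊢
      exact Finset.sdiff_subset_sdiff h.1 le_rfl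
    · intro ω h
      simp only [Finset.mem_filter, Finset.mem_powerset] at h ⊢
      refine ⟨Finset.union_subset (hF.trans hB) (h.trans Finset.sdiff_subset), ?_⟩
      ext x
      have := @h x; have := @hF x
      simp only [Finset.mem_sdiff] at *
      simp only [Finset.mem_inter, Finset.mem_union]; tauto
    · intro ω h
      simp only [Finset.mem_filter, Finset.mem_powerset] at h ⊢
      rw [← h.2]; ext x; simp only [Finset.mem_sdiff, Finset.mem_inter, Finset.mem_union]; tauto
    · intro ω h
      simp only [Finset.mem_powerset] at h ⊢
      ext x
      have := @h x; have := @hF x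
      simp only [Finset.mem_sdiff] at *
      simp only [Finset.mem_union]; tauto
    · intro ω h
      simp only [Finset.mem_filter, Finset.mem_powerset] at h
      obtain ⟨h, h'⟩ := h
      have e1 : ω.card = F.card + (ω \ B).card := by
        rw [← h', Finset.card_inter_add_card_sdiff]
      have e2 : (E \ ω).card = (B \ F).card + ((E \ B).card - (ω \ B).card) := by
        rw [← Finset.card_sdiff_of_subset (Finset.sdiff_subset_sdiff h le_rfl),
          ← Finset.card_union_of_disjoint]
        · congr 1; ext x
          have := @h x; have := @hB x
          simp only [← h', Finset.mem_sdiff, Finset.mem_inter, Finset.mem_union]; tauto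
        · rw [Finset.disjoint_left]; intro x
          simp only [Finset.mem_sdiff]; tauto
      rw [e1, e2]; ring
  rw [h1, ← Finset.mul_sum, Finset.sum_pow_mul_eq_add_pow]
  simp

namespace Ising

/-! ### Monotonicity, the Edwards–Sokal weight and censoring -/

section Dynamics

variable {V : Type*} [Fintype V] [DecidableEq V] (G : SimpleGraph V) [DecidableRel G.Adj]

/-- The vertices that have no `ω`-open neighbour of the same spin. -/
def freeSet (ω : Finset (Sym2 V)) (σ : V → Bool) : Finset V :=
  Finset.univ.filter (IsIsolatedIn (ω ∩ agreeingEdges G σ))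

/-- The probability of the edge set `ω` in Bernoulli percolation with density `1 - exp (-2β)`. -/
noncomputable def bernoulliProb (β : ℝ) (ω : Finset (Sym2 V)) : ℝ :=
  (1 - Real.exp (-2 * β)) ^ ω.card * Real.exp (-2 * β) ^ (G.edgeFinset \ ω).card

/-- The Isolated-vertex dynamics that only updates vertices in `A`, as an operator on functions. -/
noncomputable def localDynamics (β : ℝ) (A : Finset V) : Module.End ℝ ((V → Bool) → ℝ) where
  toFun f σ := ∑ ω ∈ G.edgeFinset.powerset, bernoulliProb G β ω * avg (freeSet G ω σ ∩ A) f σ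
  map_add' f g := by
    ext σ; simp [avg_add, mul_add, Finset.sum_add_distrib]
  map_smul' a f := by
    ext σ; simp [avg_smul, Finset.mul_sum, mul_left_comm]

variable {G} {β : ℝ}

lemma localDynamics_apply (A : Finset V) (f : (V → Bool) → ℝ) (σ : V → Bool) :
    localDynamics G β A f σ =
      ∑ ω ∈ G.edgeFinset.powerset, bernoulliProb G β ω * avg (freeSet G ω σ ∩ A) f σ := rfl

lemma mem_freeSet {ω : Finset (Sym2 V)} (hω : ω ⊆ G.edgeFinset) {σ : V → Bool} {v : V} :
    v ∈ freeSet G ω σ ↔ ∀ y, s(v, y) ∈ ω → σ v ≠ σ y := by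
  rw [freeSet, Finset.mem_filter, and_iff_right (Finset.mem_univ v)]
  simp only [IsIsolatedIn, agreeingEdges, Finset.mem_inter, Finset.mem_filter]
  constructor
  · intro h y hy he
    exact h s(v, y) ⟨hy, hω hy, by simpa using he⟩ (by simp)
  · rintro h e ⟨he, -, hd⟩ hv
    obtain ⟨y, rfl⟩ := Sym2.mem_iff_exists.1 hv
    exact h y he (by simpa using hd)

lemma agreeingEdges_subset (σ : V → Bool) : agreeingEdges G σ ⊆ G.edgeFinset :=
  Finset.filter_subset _ _

lemma bernoulliProb_nonneg (hβ : 0 ≤ β) (ω : Finset (Sym2 V)) : 0 ≤ bernoulliProb G β ω := by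
  have : Real.exp (-2 * β) ≤ 1 := Real.exp_le_one_iff.2 (by linarith)
  exact mul_nonneg (pow_nonneg (by linarith) _) (by positivity)

lemma sum_bernoulliProb_inter {B F : Finset (Sym2 V)} (hB : B ⊆ G.edgeFinset) (hF : F ⊆ B) :
    ∑ ω ∈ G.edgeFinset.powerset with ω ∩ B = F, bernoulliProb G β ω =
      (1 - Real.exp (-2 * β)) ^ F.card * Real.exp (-2 * β) ^ (B \ F).card :=
  Finset.sum_powerset_inter_eq _ hB hF

lemma sum_bernoulliProb : ∑ ω ∈ G.edgeFinset.powerset, bernoulliProb G β ω = 1 := by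
  have := sum_bernoulliProb_inter (G := G) (β := β) (Finset.empty_subset _) (le_refl ∅)
  simpa using this

lemma localDynamics_eq_sum_agreeing (A : Finset V) (f : (V → Bool) → ℝ) (σ : V → Bool) :
    localDynamics G β A f σ = ∑ F ∈ (agreeingEdges G σ).powerset,
      percolationProb G β σ F * avg (Finset.univ.filter (IsIsolatedIn F) ∩ A) f σ := by
  rw [localDynamics_apply, ← Finset.sum_fiberwise_of_maps_to
    (t := (agreeingEdges G σ).powerset) (g := fun ω => ω ∩ agreeingEdges G σ)
    (fun ω _ => Finset.mem_powerset.2 Finset.inter_subset_right)]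
  refine Finset.sum_congr rfl fun F hF => ?_
  rw [percolationProb, ← sum_bernoulliProb_inter (agreeingEdges_subset σ) (Finset.mem_powerset.1 hF),
    Finset.sum_mul]
  refine Finset.sum_congr rfl fun ω hω => ?_
  rw [freeSet, (Finset.mem_filter.1 hω).2]

lemma toLin'_isolatedVertexDynamics :
    Matrix.toLin' (isolatedVertexDynamics G β) = localDynamics G β Finset.univ := by
  refine LinearMap.ext fun f => funext fun σ => ?_
  rw [localDynamics_eq_sum_agreeing]
  simp only [Matrix.toLin'_apply, Matrix.mulVec, dotProduct, isolatedVertexDynamics,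
    Finset.sum_mul, Finset.inter_univ, ← sum_resampleProb_mul, Finset.mul_sum]
  rw [Finset.sum_comm]
  simp only [mul_assoc]

lemma localDynamics_const (A : Finset V) (c : ℝ) :
    localDynamics G β A (fun _ => c) = fun _ => c := by
  ext σ
  rw [localDynamics_apply]
  simp [avg_eq_of_const (S := _ ∩ A) (f := fun _ : V → Bool => c) (c := c) (fun _ => rfl),
    ← Finset.sum_mul, sum_bernoulliProb]

/-- Use the same percolation and the same fresh spins for `σ ≤ τ`. If `v` is free only in `σ`, an
open neighbour agrees with it in `τ` but not in `σ`; the common spin in `τ` is then plus, which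
dominates any fresh spin. The other case is symmetric, with minus in `σ`. -/
lemma localDynamics_mono (hβ : 0 ≤ β) (A : Finset V) {f : (V → Bool) → ℝ} (hf : Monotone f) :
    Monotone (localDynamics G β A f) := by
  intro σ τ h
  simp only [localDynamics_apply]
  refine Finset.sum_le_sum fun ω hω => mul_le_mul_of_nonneg_left ?_ (bernoulliProb_nonneg hβ ω)
  unfold avg
  gcongr with s
  apply hf
  intro v
  have hω' := Finset.mem_powerset.1 hω
  simp only [resample, Finset.mem_inter, mem_freeSet hω']
  by_cases hA : v ∈ A
  swap
  · simpa [hA] using h v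
  by_cases h1 : ∀ y, s(v, y) ∈ ω → σ v ≠ σ y <;> by_cases h2 : ∀ y, s(v, y) ∈ ω → τ v ≠ τ y
  · rw [if_pos ⟨h1, hA⟩, if_pos ⟨h2, hA⟩]
  · rw [if_pos ⟨h1, hA⟩, if_neg (by tauto)]
    push Not at h2
    obtain ⟨y, hy, he⟩ := h2
    have a := h1 y hy; have b := h v; have c := h y
    revert a b c he
    cases σ v <;> cases σ y <;> cases τ v <;> cases τ y <;> cases s v <;> simp
  · rw [if_neg (by tauto), if_pos ⟨h2, hA⟩]
    push Not at h1
    obtain ⟨y, hy, he⟩ := h1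
    have a := h2 y hy; have b := h v; have c := h y
    revert a b c he
    cases σ v <;> cases σ y <;> cases τ v <;> cases τ y <;> cases s v <;> simp
  · rw [if_neg (by tauto), if_neg (by tauto)]
    exact h v

lemma weight_pos (σ : V → Bool) : 0 < weight G β σ := Real.exp_pos _

lemma weight_eq_exp_agreeingEdges (σ : V → Bool) :
    weight G β σ = Real.exp (-β * G.edgeFinset.card) *
      Real.exp (2 * β) ^ (agreeingEdges G σ).card := by
  have h : ∀ e : Sym2 V, (e.map fun v => spin (σ v)).mul =
      2 * (if (e.map σ).IsDiag then 1 else 0) - 1 := by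
    intro e
    induction e with
    | _ x y =>
      simp only [Sym2.map_mk, Sym2.mul_mk, Sym2.mk_isDiag_iff, spin]
      cases σ x <;> cases σ y <;> norm_num
  rw [weight, ← Real.exp_nat_mul, ← Real.exp_add]
  simp only [h, Finset.sum_sub_distrib, ← Finset.mul_sum, agreeingEdges, Finset.sum_boole,
    Finset.sum_const, nsmul_eq_mul]
  congr 1; ring

/-- Edwards–Sokal: given compatibility with `F`, the joint weight no longer depends on `σ`, so spins
of isolated vertices are uniform given `F`. -/
lemma weight_mul_percolationProb {σ : V → Bool} {F : Finset (Sym2 V)}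
    (hF : F ⊆ agreeingEdges G σ) :
    weight G β σ * percolationProb G β σ F =
      Real.exp (-β * G.edgeFinset.card) * (Real.exp (2 * β) - 1) ^ F.card := by
  have h1 : (agreeingEdges G σ).card = F.card + (agreeingEdges G σ \ F).card := by
    rw [Finset.card_sdiff_of_subset hF]; have := Finset.card_le_card hF; omega
  have h2 : Real.exp (2 * β) * Real.exp (-2 * β) = 1 := by rw [← Real.exp_add]; simp
  rw [weight_eq_exp_agreeingEdges, percolationProb, h1, pow_add]
  calc _ = Real.exp (-β * G.edgeFinset.card) *
        (Real.exp (2 * β) * (1 - Real.exp (-2 * β))) ^ F.card *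
        (Real.exp (2 * β) * Real.exp (-2 * β)) ^ (agreeingEdges G σ \ F).card := by
        rw [mul_pow, mul_pow]; ring
    _ = _ := by rw [h2, mul_sub, h2]; simp

/-- The joint weight of a spin configuration and a set of edges. -/
noncomputable def jointWeight (G : SimpleGraph V) [DecidableRel G.Adj] (β : ℝ)
    (F : Finset (Sym2 V)) (σ : V → Bool) : ℝ :=
  if F ⊆ agreeingEdges G σ then
    Real.exp (-β * G.edgeFinset.card) * (Real.exp (2 * β) - 1) ^ F.card else 0

lemma jointWeight_nonneg (hβ : 0 ≤ β) (F : Finset (Sym2 V)) (σ : V → Bool) :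
    0 ≤ jointWeight G β F σ := by
  unfold jointWeight
  split_ifs
  · have : 1 ≤ Real.exp (2 * β) := Real.one_le_exp (by linarith)
    exact mul_nonneg (Real.exp_pos _).le (pow_nonneg (by linarith) _)
  · rfl

lemma jointWeight_resample {F : Finset (Sym2 V)} {S : Finset V}
    (hS : ∀ v ∈ S, IsIsolatedIn F v) (s σ : V → Bool) :
    jointWeight G β F (resample S s σ) = jointWeight G β F σ := by
  have : F ⊆ agreeingEdges G (resample S s σ) ↔ F ⊆ agreeingEdges G σ := by
    simp only [Finset.subset_iff, agreeingEdges, Finset.mem_filter]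
    refine forall₂_congr fun e he => and_congr_right fun _ => ?_
    induction e with
    | _ x y =>
      have hx : x ∉ S := fun h => hS x h _ he (by simp)
      have hy : y ∉ S := fun h => hS y h _ he (by simp)
      simp [resample, hx, hy]
  simp [jointWeight, this]

lemma sum_weight_mul_localDynamics (A : Finset V) (f g : (V → Bool) → ℝ) :
    ∑ σ, weight G β σ * localDynamics G β A f σ * g σ =
      ∑ F ∈ G.edgeFinset.powerset, ∑ σ, jointWeight G β F σ *
        avg (Finset.univ.filter (IsIsolatedIn F) ∩ A) f σ * g σ := by
  rw [Finset.sum_comm]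
  refine Finset.sum_congr rfl fun σ _ => ?_
  rw [localDynamics_eq_sum_agreeing, Finset.mul_sum, Finset.sum_mul]
  refine (Finset.sum_congr rfl fun F hF => ?_).trans (Finset.sum_subset
    (Finset.powerset_mono.2 (agreeingEdges_subset σ)) fun F _ hF => ?_)
  · rw [← mul_assoc, weight_mul_percolationProb (Finset.mem_powerset.1 hF), jointWeight,
      if_pos (Finset.mem_powerset.1 hF)]
  · rw [jointWeight, if_neg (fun h => hF (Finset.mem_powerset.2 h))]; simp

lemma sum_weight_mul_localDynamics_symm (A : Finset V) (f g : (V → Bool) → ℝ) :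
    ∑ σ, weight G β σ * localDynamics G β A f σ * g σ =
      ∑ σ, weight G β σ * f σ * localDynamics G β A g σ := by
  have : ∑ σ, weight G β σ * f σ * localDynamics G β A g σ =
      ∑ σ, weight G β σ * localDynamics G β A g σ * f σ :=
    Finset.sum_congr rfl fun σ _ => by ring
  rw [this, sum_weight_mul_localDynamics, sum_weight_mul_localDynamics]
  refine Finset.sum_congr rfl fun F _ => ?_
  rw [sum_mul_avg_symm (jointWeight_resample (by simp +contextual))]
  exact Finset.sum_congr rfl fun σ _ => by ring

/-- Censoring: restricting the updates to `A` increases correlations of monotone functions. -/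
lemma sum_weight_mul_localDynamics_univ_le (hβ : 0 ≤ β) (A : Finset V) {f g : (V → Bool) → ℝ}
    (hf : Monotone f) (hg : Monotone g) :
    ∑ σ, weight G β σ * localDynamics G β Finset.univ f σ * g σ ≤
      ∑ σ, weight G β σ * localDynamics G β A f σ * g σ := by
  rw [sum_weight_mul_localDynamics, sum_weight_mul_localDynamics]
  refine Finset.sum_le_sum fun F _ => ?_
  set S := Finset.univ.filter (IsIsolatedIn F) with hS
  have h : S ∩ Finset.univ = (S \ A) ∪ (S ∩ A) := by
    rw [Finset.sdiff_union_inter, Finset.inter_univ]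
  rw [h, ← avg_avg]
  -- The full update is the censored one followed by averaging over the isolated vertices outside
  -- `A`, and this extra averaging lowers the correlation.
  refine sum_mul_avg_le (jointWeight_nonneg hβ F) (fun v hv => jointWeight_resample ?_)
    (avg_mono hf _) hg
  have : IsIsolatedIn F v := (Finset.mem_filter.1 (Finset.mem_sdiff.1 hv).1).2
  simpa using this

lemma localDynamics_pow_mono (hβ : 0 ≤ β) (A : Finset V) (t : ℕ) {f : (V → Bool) → ℝ}
    (hf : Monotone f) : Monotone ((localDynamics G β A ^ t) f) := by
  induction t with
  | zero => simpa using hf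
  | succ t ih => rw [pow_succ']; exact localDynamics_mono hβ A ih

lemma sum_weight_mul_localDynamics_pow_symm (A : Finset V) (t : ℕ) (f g : (V → Bool) → ℝ) :
    ∑ σ, weight G β σ * (localDynamics G β A ^ t) f σ * g σ =
      ∑ σ, weight G β σ * f σ * (localDynamics G β A ^ t) g σ := by
  induction t generalizing f with
  | zero => simp
  | succ t ih =>
    rw [pow_succ, Module.End.mul_apply, ih, sum_weight_mul_localDynamics_symm, ← Module.End.mul_apply,
      ← pow_succ', pow_succ]

/-- Steps are censored one at a time; each censored step moves to `g` by self-adjointness, and both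
functions stay monotone throughout. -/
lemma sum_weight_mul_localDynamics_pow_le (hβ : 0 ≤ β) (A : Finset V) (t : ℕ)
    {f g : (V → Bool) → ℝ} (hf : Monotone f) (hg : Monotone g) :
    ∑ σ, weight G β σ * (localDynamics G β Finset.univ ^ t) f σ * g σ ≤
      ∑ σ, weight G β σ * f σ * (localDynamics G β A ^ t) g σ := by
  induction t generalizing g with
  | zero => simp
  | succ t ih =>
    rw [pow_succ', pow_succ, Module.End.mul_apply, Module.End.mul_apply]
    refine (sum_weight_mul_localDynamics_univ_le hβ A (localDynamics_pow_mono hβ _ t hf) hg).trans ?_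
    rw [sum_weight_mul_localDynamics_symm]
    exact ih (localDynamics_mono hβ A hg)

lemma single_top_mono : Monotone (Pi.single (⊤ : V → Bool) (1 : ℝ)) := by
  intro σ τ h
  by_cases hσ : σ = ⊤
  · subst hσ; rw [top_le_iff.1 h]
  · rw [Pi.single_eq_of_ne hσ]
    by_cases hτ : τ = ⊤ <;> simp [hτ]

lemma neg_single_bot_mono : Monotone (-Pi.single (⊥ : V → Bool) (1 : ℝ)) := by
  intro σ τ h
  by_cases hτ : τ = ⊥
  · subst hτ; rw [le_bot_iff.1 h]
  · simp only [Pi.neg_apply, Pi.single_eq_of_ne hτ]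
    by_cases hσ : σ = ⊥ <;> simp [hσ]

/-- Censored updates before the last `t` steps move the extremal starting points apart. -/
lemma localDynamics_pow_add_top_le (hβ : 0 ≤ β) (A : Finset V) (t T : ℕ) {g : (V → Bool) → ℝ}
    (hg : Monotone g) :
    (localDynamics G β Finset.univ ^ (t + T)) g ⊤ ≤
      (localDynamics G β Finset.univ ^ t) ((localDynamics G β A ^ T) g) ⊤ := by
  -- Testing against the increasing indicator of `⊤`, evolved for `t` steps, turns the correlation
  -- inequality into a pointwise one at `⊤`.
  have key := sum_weight_mul_localDynamics_pow_le (G := G) hβ A T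
    (localDynamics_pow_mono (G := G) hβ Finset.univ t (single_top_mono (V := V))) hg
  rw [← Module.End.mul_apply, ← pow_add, sum_weight_mul_localDynamics_pow_symm,
    sum_weight_mul_localDynamics_pow_symm] at key
  simp only [Pi.single_apply, mul_ite, ite_mul, mul_one, mul_zero, zero_mul, Finset.sum_ite_eq',
    Finset.mem_univ, if_true] at key
  rw [add_comm T t] at key
  exact le_of_mul_le_mul_left key (weight_pos _)

lemma localDynamics_pow_add_bot_ge (hβ : 0 ≤ β) (A : Finset V) (t T : ℕ) {g : (V → Bool) → ℝ}
    (hg : Monotone g) :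
    (localDynamics G β Finset.univ ^ t) ((localDynamics G β A ^ T) g) ⊥ ≤
      (localDynamics G β Finset.univ ^ (t + T)) g ⊥ := by
  have key := sum_weight_mul_localDynamics_pow_le (G := G) hβ A T
    (localDynamics_pow_mono (G := G) hβ Finset.univ t (neg_single_bot_mono (V := V))) hg
  rw [← Module.End.mul_apply, ← pow_add, sum_weight_mul_localDynamics_pow_symm,
    sum_weight_mul_localDynamics_pow_symm] at key
  simp only [Pi.neg_apply, Pi.single_apply, mul_ite, ite_mul, mul_one, mul_zero, zero_mul,
    mul_neg, neg_mul, Finset.sum_neg_distrib, Finset.sum_ite_eq', Finset.mem_univ, if_true,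
    neg_le_neg_iff] at key
  rw [add_comm T t] at key
  exact le_of_mul_le_mul_left key (weight_pos _)

end Dynamics

/-! ### Convergence to equilibrium inside a block -/

section Block

variable {V : Type*} [Fintype V] [DecidableEq V] {G : SimpleGraph V} [DecidableRel G.Adj] {β : ℝ}

/-- The expectation of `f` under the probability measure with weight `W`, conditioned on the
spins of `η` outside of `S`. -/
noncomputable def blockMean (W : (V → Bool) → ℝ) (S : Finset V) (f : (V → Bool) → ℝ)
    (η : V → Bool) : ℝ :=
  avg S (W * f) η / avg S W η

lemma blockMean_le {W : (V → Bool) → ℝ} (hW : ∀ σ, 0 < W σ) {S : Finset V}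
    {f : (V → Bool) → ℝ} {η : V → Bool} {b : ℝ} (h : ∀ s, f (resample S s η) ≤ b) :
    blockMean W S f η ≤ b := by
  rw [blockMean, div_le_iff₀ (avg_pos hW η), ← avg_smul]
  refine avg_le_avg fun s => ?_
  simpa [mul_comm] using mul_le_mul_of_nonneg_left (h s) (hW (resample S s η)).le

lemma le_blockMean {W : (V → Bool) → ℝ} (hW : ∀ σ, 0 < W σ) {S : Finset V}
    {f : (V → Bool) → ℝ} {η : V → Bool} {b : ℝ} (h : ∀ s, b ≤ f (resample S s η)) :
    b ≤ blockMean W S f η := by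
  rw [blockMean, le_div_iff₀ (avg_pos hW η), ← avg_smul]
  refine avg_le_avg fun s => ?_
  simpa [mul_comm] using mul_le_mul_of_nonneg_left (h s) (hW (resample S s η)).le

lemma resample_eq_of_eqOn_compl {S : Finset V} {s σ τ : V → Bool} (h : ∀ v ∉ S, σ v = τ v) :
    resample S s σ = resample S s τ := by
  ext v; by_cases hv : v ∈ S <;> simp [resample, hv, h]

lemma avg_eq_of_eqOn_compl {S : Finset V} {σ τ : V → Bool} (h : ∀ v ∉ S, σ v = τ v)
    (f : (V → Bool) → ℝ) : avg S f σ = avg S f τ :=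
  avg_congr fun s => by rw [resample_eq_of_eqOn_compl h]

/-- Stationarity of the conditional Gibbs measure: test reversibility against the indicator of the
configurations equal to `η` off `A`, which the censored dynamics fixes. -/
lemma avg_weight_mul_localDynamics (A : Finset V) (f : (V → Bool) → ℝ) (η : V → Bool) :
    avg A (weight G β * localDynamics G β A f) η = avg A (weight G β * f) η := by
  classical
  let g : (V → Bool) → ℝ := fun σ => if ∀ v ∉ A, σ v = η v then 1 else 0
  have hg : ∀ B ⊆ A, ∀ s σ, g (resample B s σ) = g σ := by
    intro B hB s σ
    have : (∀ v ∉ A, resample B s σ v = η v) ↔ ∀ v ∉ A, σ v = η v :=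
      forall₂_congr fun v hv => by simp [resample, show v ∉ B from fun h => hv (hB h)]
    simp [g, this]
  have hgP : localDynamics G β A g = g := by
    ext σ
    rw [localDynamics_apply]
    simp only [avg_eq_of_const (hg _ Finset.inter_subset_right · _)]
    rw [← Finset.sum_mul, sum_bernoulliProb, one_mul]
  have key : ∀ h : (V → Bool) → ℝ, (∑ σ, g σ) * avg A h η = ∑ σ, h σ * g σ := by
    intro h
    have := sum_mul_avg_symm (S := A) (c := fun _ => 1) (fun _ _ => rfl) h g
    simp only [one_mul, avg_eq_of_const (hg _ le_rfl · _)] at this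
    rw [← this, Finset.sum_mul]
    refine Finset.sum_congr rfl fun σ _ => ?_
    by_cases hσ : ∀ v ∉ A, σ v = η v
    · rw [avg_eq_of_eqOn_compl hσ]; ring
    · simp [g, hσ]
  have hpos : 0 < ∑ σ, g σ := by
    refine Finset.sum_pos' (fun σ _ => by simp only [g]; split_ifs <;> norm_num)
      ⟨η, Finset.mem_univ _, by simp [g]⟩
  refine mul_left_cancel₀ hpos.ne' ?_
  rw [key, key]
  simp only [Pi.mul_apply]
  rw [sum_weight_mul_localDynamics_symm, hgP]

lemma blockMean_localDynamics_pow (A : Finset V) (f : (V → Bool) → ℝ) (T : ℕ) (η : V → Bool) :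
    blockMean (weight G β) A ((localDynamics G β A ^ T) f) η = blockMean (weight G β) A f η := by
  induction T with
  | zero => simp
  | succ T ih =>
    rw [← ih, pow_succ']
    unfold blockMean
    rw [Module.End.mul_apply, avg_weight_mul_localDynamics]

lemma card_edges_touching_le {d : ℕ} (hd : G.maxDegree ≤ d) (A : Finset V) :
    (G.edgeFinset.filter fun e => ∃ v ∈ A, v ∈ e).card ≤ d * A.card := by
  have : (G.edgeFinset.filter fun e => ∃ v ∈ A, v ∈ e) = A.biUnion fun v => G.incidenceFinset v := by
    ext e
    simp only [Finset.mem_filter, Finset.mem_biUnion, SimpleGraph.incidenceFinset_eq_filter]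
    tauto
  rw [this, mul_comm]
  refine Finset.card_biUnion_le_card_mul _ _ _ fun v _ => ?_
  rw [SimpleGraph.card_incidenceFinset_eq_degree]
  exact (G.degree_le_maxDegree v).trans hd

/-- Minorization: with at least the stated probability all edges touching `A` are closed, and then
all of `A` is resampled uniformly. -/
lemma mul_avg_le_localDynamics (hβ : 0 ≤ β) {d : ℕ} (hd : G.maxDegree ≤ d) {A : Finset V}
    {f : (V → Bool) → ℝ} {σ : V → Bool} (hf : ∀ τ, (∀ v ∉ A, τ v = σ v) → 0 ≤ f τ) :
    Real.exp (-2 * β) ^ (d * A.card) * avg A f σ ≤ localDynamics G β A f σ := by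
  set B := G.edgeFinset.filter fun e => ∃ v ∈ A, v ∈ e with hB
  have h0 : ∀ S : Finset V, 0 ≤ avg (S ∩ A) f σ := by
    intro S
    have := avg_le_avg (S := S ∩ A) (f := fun _ => 0) (g := f) (σ := σ)
      (fun s => hf _ fun v hv => by simp [resample, hv])
    rwa [avg_eq_of_const (c := 0) (fun _ => rfl)] at this
  have h1 : Real.exp (-2 * β) ^ (d * A.card) ≤ Real.exp (-2 * β) ^ B.card :=
    pow_le_pow_of_le_one (Real.exp_pos _).le (Real.exp_le_one_iff.2 (by linarith))
      (card_edges_touching_le hd A)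
  have h2 : ∑ ω ∈ G.edgeFinset.powerset with ω ∩ B = ∅, bernoulliProb G β ω =
      Real.exp (-2 * β) ^ B.card := by
    rw [sum_bernoulliProb_inter (Finset.filter_subset _ _) (Finset.empty_subset _)]
    simp [hB]
  have hA : 0 ≤ avg A f σ := by simpa using h0 A
  calc _ ≤ Real.exp (-2 * β) ^ B.card * avg A f σ := mul_le_mul_of_nonneg_right h1 hA
    _ = ∑ ω ∈ G.edgeFinset.powerset with ω ∩ B = ∅,
        bernoulliProb G β ω * avg (freeSet G ω σ ∩ A) f σ := by
      rw [← h2, Finset.sum_mul]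
      refine Finset.sum_congr rfl fun ω hω => ?_
      rw [Finset.mem_filter, Finset.mem_powerset] at hω
      have : freeSet G ω σ ∩ A = A := by
        rw [Finset.inter_eq_right]
        intro v hv
        rw [mem_freeSet hω.1]
        intro y hy
        have : s(v, y) ∈ ω ∩ B :=
          Finset.mem_inter.2 ⟨hy, Finset.mem_filter.2 ⟨hω.1 hy, v, hv, by simp⟩⟩
        rw [hω.2] at this
        simp at this
      rw [this]
    _ ≤ _ := by
      rw [localDynamics_apply]
      exact Finset.sum_le_sum_of_subset_of_nonneg (Finset.filter_subset _ _)
        fun ω _ _ => mul_nonneg (bernoulliProb_nonneg hβ ω) (h0 _)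

/-- Doeblin contraction of oscillations on the configurations that agree outside of `A`. -/
lemma localDynamics_sub_le (hβ : 0 ≤ β) {d : ℕ} (hd : G.maxDegree ≤ d) {A : Finset V}
    {f : (V → Bool) → ℝ} {c : ℝ} (hf : ∀ σ τ, (∀ v ∉ A, σ v = τ v) → f σ - f τ ≤ c)
    {σ τ : V → Bool} (h : ∀ v ∉ A, σ v = τ v) :
    localDynamics G β A f σ - localDynamics G β A f τ ≤
      (1 - Real.exp (-2 * β) ^ (d * A.card)) * c := by
  classical
  set δ := Real.exp (-2 * β) ^ (d * A.card) with hδ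
  have hδ1 : δ ≤ 1 := pow_le_one₀ (Real.exp_pos _).le (Real.exp_le_one_iff.2 (by linarith))
  let R := Finset.univ.filter fun ρ : V → Bool => ∀ v ∉ A, ρ v = σ v
  have hR : R.Nonempty := ⟨σ, by simp [R]⟩
  obtain ⟨x, hx, hxM⟩ := R.exists_max_image f hR
  obtain ⟨y, hy, hym⟩ := R.exists_min_image f hR
  simp only [R, Finset.mem_filter, Finset.mem_univ, true_and] at hx hy hxM hym
  -- The minorization is applied to `max f - f` at `σ` and to `f - min f` at `τ`; the uniform
  -- averages coincide and cancel.
  have h1 := mul_avg_le_localDynamics (G := G) hβ hd (A := A) (f := (fun _ => f x) - f) (σ := σ)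
    (fun ρ hρ => sub_nonneg.2 (hxM ρ hρ))
  have h2 := mul_avg_le_localDynamics (G := G) hβ hd (A := A) (f := f - (fun _ => f y)) (σ := τ)
    (fun ρ hρ => sub_nonneg.2 (hym ρ fun v hv => (hρ v hv).trans (h v hv).symm))
  have avg_sub : ∀ (g g' : (V → Bool) → ℝ) ρ, avg A (g - g') ρ = avg A g ρ - avg A g' ρ := by
    intro g g' ρ; simp [avg, sub_div]
  have avg_const : ∀ (a : ℝ) ρ, avg A (fun _ => a) ρ = a :=
    fun a ρ => avg_eq_of_const fun _ => rfl
  rw [map_sub, localDynamics_const, Pi.sub_apply, avg_sub, avg_const, ← hδ] at h1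
  rw [map_sub, localDynamics_const, Pi.sub_apply, avg_sub, avg_const, ← hδ] at h2
  rw [avg_eq_of_eqOn_compl h] at h1
  have h3 := hf x y fun v hv => (hx v hv).trans (hy v hv).symm
  have h4 := mul_le_mul_of_nonneg_left h3 (sub_nonneg.2 hδ1)
  linarith

lemma localDynamics_pow_sub_le (hβ : 0 ≤ β) {d : ℕ} (hd : G.maxDegree ≤ d) {A : Finset V}
    {f : (V → Bool) → ℝ} {c : ℝ} (hf : ∀ σ τ, (∀ v ∉ A, σ v = τ v) → f σ - f τ ≤ c) (T : ℕ)
    {σ τ : V → Bool} (h : ∀ v ∉ A, σ v = τ v) :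
    (localDynamics G β A ^ T) f σ - (localDynamics G β A ^ T) f τ ≤
      (1 - Real.exp (-2 * β) ^ (d * A.card)) ^ T * c := by
  induction T generalizing σ τ with
  | zero => simpa using hf σ τ h
  | succ T ih =>
    rw [pow_succ', pow_succ', mul_assoc]
    exact localDynamics_sub_le hβ hd (fun _ _ h => ih h) h

lemma abs_localDynamics_pow_sub_blockMean_le (hβ : 0 ≤ β) {d : ℕ} (hd : G.maxDegree ≤ d)
    {A : Finset V} {f : (V → Bool) → ℝ} {c : ℝ}
    (hf : ∀ σ τ, (∀ v ∉ A, σ v = τ v) → f σ - f τ ≤ c) (T : ℕ) (σ : V → Bool) :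
    |(localDynamics G β A ^ T) f σ - blockMean (weight G β) A f σ| ≤
      (1 - Real.exp (-2 * β) ^ (d * A.card)) ^ T * c := by
  rw [← blockMean_localDynamics_pow A f T σ, abs_sub_le_iff]
  constructor
  · rw [sub_le_comm]
    refine le_blockMean weight_pos fun s => ?_
    rw [sub_le_comm]
    exact localDynamics_pow_sub_le hβ hd hf T fun v hv => by simp [resample, hv]
  · rw [sub_le_iff_le_add]
    refine blockMean_le weight_pos fun s => ?_
    rw [← sub_le_iff_le_add]
    exact localDynamics_pow_sub_le hβ hd hf T fun v hv => by simp [resample, hv]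

lemma localDynamics_congr {A B : Finset V} (hAB : A ⊆ B)
    (hN : ∀ v ∈ A, ∀ y, G.Adj v y → y ∈ B) {f : (V → Bool) → ℝ}
    (hf : ∀ σ τ, (∀ v ∈ B, σ v = τ v) → f σ = f τ) {σ τ : V → Bool} (h : ∀ v ∈ B, σ v = τ v) :
    localDynamics G β A f σ = localDynamics G β A f τ := by
  simp only [localDynamics_apply]
  refine Finset.sum_congr rfl fun ω hω => ?_
  have hω' := Finset.mem_powerset.1 hω
  have : freeSet G ω σ ∩ A = freeSet G ω τ ∩ A := by
    ext v
    simp only [Finset.mem_inter, mem_freeSet hω']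
    refine and_congr_left fun hv => forall₂_congr fun y hy => ?_
    have : G.Adj v y := by simpa using hω' hy
    rw [h v (hAB hv), h y (hN v hv y this)]
  rw [this]
  congr 1
  refine avg_congr fun s => hf _ _ fun v hv => ?_
  simp [resample, h v hv]

lemma localDynamics_pow_congr {A B : Finset V} (hAB : A ⊆ B)
    (hN : ∀ v ∈ A, ∀ y, G.Adj v y → y ∈ B) {f : (V → Bool) → ℝ}
    (hf : ∀ σ τ, (∀ v ∈ B, σ v = τ v) → f σ = f τ) (T : ℕ) {σ τ : V → Bool}
    (h : ∀ v ∈ B, σ v = τ v) :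
    (localDynamics G β A ^ T) f σ = (localDynamics G β A ^ T) f τ := by
  induction T generalizing σ τ with
  | zero => simpa using hf σ τ h
  | succ T ih =>
    rw [pow_succ']
    exact localDynamics_congr hAB hN (fun _ _ h => ih h) h

end Block

/-! ### Influence of a pinned spin and non-backtracking walks -/

section Influence

variable {V : Type*} [Fintype V] [DecidableEq V] (G : SimpleGraph V) [DecidableRel G.Adj]

/-- `W` is an Ising weight on `G` with inverse temperature `β` and arbitrary external fields. -/
def IsIsingWeight (β : ℝ) (W : (V → Bool) → ℝ) : Prop :=
  (∀ σ, 0 < W σ) ∧ ∀ u, ∃ C > 0, ∀ σ, W (Function.update σ u true) =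
    C * W (Function.update σ u false) *
      Real.exp (2 * β * ∑ y ∈ G.neighborFinset u, spin (σ y))

/-- The number of non-backtracking walks of length `k` from `u` to `v` whose first step does not
go to `p`. -/
def nbWalks (v : V) : ℕ → V → V → ℝ
  | 0, _, u => if u = v then 1 else 0
  | k + 1, p, u => ∑ w ∈ (G.neighborFinset u).erase p, nbWalks v k u w

variable {G} {β : ℝ} {W : (V → Bool) → ℝ}

lemma isIsingWeight_weight : IsIsingWeight G β (weight G β) := by
  refine ⟨weight_pos, fun u => ⟨1, one_pos, fun σ => ?_⟩⟩
  rw [one_mul, weight, weight, ← Real.exp_add]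
  congr 1
  have h1 : ∀ b, ∑ e ∈ G.edgeFinset, (e.map fun v => spin (Function.update σ u b v)).mul =
      ∑ e ∈ G.edgeFinset \ G.incidenceFinset u, (e.map fun v => spin (σ v)).mul +
        ∑ y ∈ G.neighborFinset u, spin b * spin (σ y) := by
    intro b
    rw [← Finset.sum_sdiff (G.incidenceFinset_subset u)]
    congr 1
    · refine Finset.sum_congr rfl fun e he => ?_
      simp only [Finset.mem_sdiff, SimpleGraph.incidenceFinset_eq_filter, Finset.mem_filter,
        not_and] at he
      have hu := he.2 he.1
      congr 1
      refine Sym2.map_congr fun v hv => ?_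
      rw [Function.update_of_ne]
      rintro rfl; exact hu hv
    · symm
      refine Finset.sum_bij (fun y _ => s(u, y)) ?_ ?_ ?_ ?_
      · intro y hy
        simpa using hy
      · intro y _ z _ h
        exact Sym2.congr_right.1 h
      · intro e he
        rw [SimpleGraph.incidenceFinset_eq_filter, Finset.mem_filter] at he
        obtain ⟨y, rfl⟩ := Sym2.mem_iff_exists.1 he.2
        exact ⟨y, by simpa using he.1, rfl⟩
      · intro y hy
        have : y ≠ u := by
          rintro rfl; simp at hy
        simp [Function.update_of_ne this]
  rw [h1, h1]
  simp only [spin, if_true, Bool.false_eq_true, if_false, ← Finset.mul_sum]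
  ring

lemma IsIsingWeight.tilt (hW : IsIsingWeight G β W) (w : V) (a : ℝ) :
    IsIsingWeight G β (fun σ => W σ * Real.exp (a * spin (σ w))) := by
  refine ⟨fun σ => mul_pos (hW.1 σ) (Real.exp_pos _), fun u => ?_⟩
  obtain ⟨C, hC, h⟩ := hW.2 u
  by_cases hu : w = u
  · subst hu
    refine ⟨C * Real.exp (2 * a), by positivity, fun σ => ?_⟩
    simp only [h, Function.update_self, spin, if_true, Bool.false_eq_true, if_false]
    have : Real.exp (a * 1) = Real.exp (2 * a) * Real.exp (a * -1) := by
      rw [← Real.exp_add]; congr 1; ring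
    rw [this]; ring
  · refine ⟨C, hC, fun σ => ?_⟩
    simp only [h, Function.update_of_ne hu]
    ring

lemma IsIsingWeight.tilt_sum (hW : IsIsingWeight G β W) (Y : Finset V) (a : ℝ) :
    IsIsingWeight G β (fun σ => W σ * Real.exp (a * ∑ y ∈ Y, spin (σ y))) := by
  induction Y using Finset.induction_on with
  | empty => simpa using hW
  | insert w Y hw ih =>
    convert! ih.tilt w a using 2 with σ
    rw [Finset.sum_insert hw, mul_assoc, ← Real.exp_add]
    congr 2; ring

lemma avg_eq_half_add {S : Finset V} {w : V} (hw : w ∈ S) (g : (V → Bool) → ℝ) (η : V → Bool) :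
    avg S g η = (avg (S.erase w) g (Function.update η w true) +
      avg (S.erase w) g (Function.update η w false)) / 2 := by
  have hS : S = {w} ∪ S.erase w := by
    rw [← Finset.insert_eq, Finset.insert_erase hw]
  conv_lhs => rw [hS, ← avg_avg]
  set h := avg (S.erase w) g
  have h1 : ∀ s, resample {w} s η = Function.update η w (s w) := by
    intro s; ext v; by_cases hv : v = w
    · subst hv; simp [resample]
    · simp [resample, hv]
  let e : Equiv.Perm (V → Bool) := Function.Involutive.toPerm
    (fun s => Function.update s w (!s w)) (fun s => by simp)
  have h2 := Equiv.sum_comp e (fun s : V → Bool => h (Function.update η w (s w)))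
  have h3 : ∀ s, e s w = !s w := fun s => by
    change Function.update s w (!s w) w = _; simp
  have h4 : ∑ s : V → Bool, h (Function.update η w (s w)) +
      ∑ s : V → Bool, h (Function.update η w (!s w)) = 2 ^ Fintype.card V *
        (h (Function.update η w true) + h (Function.update η w false)) := by
    rw [← Finset.sum_add_distrib]
    rw [Finset.sum_congr rfl (g := fun _ => h (Function.update η w true) +
      h (Function.update η w false))]
    · simp [mul_add]
    · intro s _
      cases s w
      · simp [add_comm]
      · simp
  simp only [h3] at h2
  rw [h2] at h4
  have h5 : (0 : ℝ) < 2 ^ Fintype.card V := by positivity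
  unfold avg
  simp only [h1]
  rw [div_eq_div_iff h5.ne' two_ne_zero]
  linarith

lemma tanh_eq_div (β : ℝ) :
    Real.tanh β = (Real.exp (2 * β) - 1) / (Real.exp (2 * β) + 1) := by
  have h : Real.exp (2 * β) = Real.exp β * Real.exp β := by rw [← Real.exp_add]; congr 1; ring
  have h1 := Real.exp_pos β
  rw [Real.tanh_eq_sinh_div_cosh, Real.sinh_eq, Real.cosh_eq, h, Real.exp_neg]
  field_simp

lemma tanh_nonneg (hβ : 0 ≤ β) : 0 ≤ Real.tanh β := by
  rw [tanh_eq_div]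
  exact div_nonneg (sub_nonneg.2 (Real.one_le_exp (by linarith))) (by positivity)

/-- A field multiplying the plus weight by `a` and dividing the minus weight by `a` shifts the plus
probability most when `a * X = Y`. With `a = exp (2β)` the bound is `tanh β`. -/
lemma tilted_mean_sub_le {a X Y : ℝ} (ha : 1 ≤ a) (hX : 0 < X) (hY : 0 < Y) :
    0 ≤ a * X / (a * X + Y / a) - X / (X + Y) ∧
      a * X / (a * X + Y / a) - X / (X + Y) ≤ (a - 1) / (a + 1) := by
  have ha0 : 0 < a := by linarith
  have e : a * X / (a * X + Y / a) - X / (X + Y) =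
      (a - 1) / (a + 1) * (X * Y * (a + 1) ^ 2 / ((a * a * X + Y) * (X + Y))) := by
    field_simp
    ring
  have h1 : 0 ≤ (a - 1) / (a + 1) := div_nonneg (by linarith) (by linarith)
  rw [e]
  refine ⟨mul_nonneg h1 (by positivity), mul_le_of_le_one_right h1 ?_⟩
  rw [div_le_one (by positivity)]
  nlinarith [sq_nonneg (a * X - Y)]

/-- Increasing the external field at `w` by `2β` changes a block expectation by at most `tanh β`
times the influence of a pinned spin at `w`. -/
lemma blockMean_tilt_sub_le (hβ : 0 ≤ β) (hW : ∀ σ, 0 < W σ) {S : Finset V} {w : V} (hw : w ∈ S)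
    (f : (V → Bool) → ℝ) (η : V → Bool) {b : ℝ} (hb : 0 ≤ b)
    (h : blockMean W (S.erase w) f (Function.update η w true) -
      blockMean W (S.erase w) f (Function.update η w false) ≤ b) :
    blockMean (fun σ => W σ * Real.exp (2 * β * spin (σ w))) S f η - blockMean W S f η ≤
      Real.tanh β * b := by
  set a := Real.exp (2 * β) with ha
  have ha1 : 1 ≤ a := Real.one_le_exp (by linarith)
  have ha0 : 0 < a := by linarith
  set X := avg (S.erase w) W (Function.update η w true) with hX
  set Y := avg (S.erase w) W (Function.update η w false) with hY
  set p := avg (S.erase w) (W * f) (Function.update η w true) with hp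
  set q := avg (S.erase w) (W * f) (Function.update η w false) with hq
  have hX0 : 0 < X := avg_pos hW _
  have hY0 : 0 < Y := avg_pos hW _
  have e1 : ∀ g : (V → Bool) → ℝ, ∀ c, avg (S.erase w)
      ((fun σ => W σ * Real.exp (2 * β * spin (σ w))) * g) (Function.update η w c) =
      Real.exp (2 * β * spin c) * avg (S.erase w) (W * g) (Function.update η w c) := by
    intro g c
    rw [← avg_smul]
    refine avg_congr fun s => ?_
    simp [resample]; ring
  have e2 : ∀ c, avg (S.erase w)
      (fun σ => W σ * Real.exp (2 * β * spin (σ w))) (Function.update η w c) =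
      Real.exp (2 * β * spin c) * avg (S.erase w) W (Function.update η w c) := by
    intro c
    have := e1 1 c
    simpa using this
  have ha' : Real.exp (2 * β * spin false) = a⁻¹ := by
    rw [ha, ← Real.exp_neg]; simp [spin]
  have ha'' : Real.exp (2 * β * spin true) = a := by simp [spin, ha]
  have h' : p / X - q / Y ≤ b := h
  -- Given the spin at `w` the tilt is constant, so it only changes the mixture of the two
  -- conditional means.
  have e : blockMean (fun σ => W σ * Real.exp (2 * β * spin (σ w))) S f η - blockMean W S f η =
      (a * X / (a * X + Y / a) - X / (X + Y)) * (p / X - q / Y) := by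
    unfold blockMean
    rw [avg_eq_half_add hw, avg_eq_half_add hw, avg_eq_half_add hw, avg_eq_half_add hw, e1, e1,
      e2, e2, ha', ha'', ← hX, ← hY, ← hp, ← hq]
    field_simp
    ring
  obtain ⟨h1, h2⟩ := tilted_mean_sub_le ha1 hX0 hY0
  rw [e, tanh_eq_div]
  exact (mul_le_mul_of_nonneg_left h' h1).trans (mul_le_mul_of_nonneg_right h2 hb)

lemma nbWalks_nonneg (v : V) (k : ℕ) (p u : V) : 0 ≤ nbWalks G v k p u := by
  induction k generalizing p u with
  | zero => unfold nbWalks; split_ifs <;> norm_num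
  | succ k ih => exact Finset.sum_nonneg fun w _ => ih u w

lemma blockMean_tilt_sum_sub_le (hβ : 0 ≤ β) {S : Finset V}
    (f : (V → Bool) → ℝ) (η : V → Bool) {b : V → ℝ} (hb : ∀ w, 0 ≤ b w)
    (h : ∀ W, IsIsingWeight G β W → ∀ w ∈ S,
      blockMean W (S.erase w) f (Function.update η w true) -
      blockMean W (S.erase w) f (Function.update η w false) ≤ b w)
    (hW : IsIsingWeight G β W) {Y : Finset V} (hY : Y ⊆ S) :
    blockMean (fun σ => W σ * Real.exp (2 * β * ∑ y ∈ Y, spin (σ y))) S f η - blockMean W S f η ≤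
      Real.tanh β * ∑ w ∈ Y, b w := by
  induction Y using Finset.induction_on with
  | empty => simp
  | insert w Y hw ih =>
    have h1 := ih ((Finset.subset_insert _ _).trans hY)
    have hW' := hW.tilt_sum Y (2 * β)
    have hwS := hY (Finset.mem_insert_self w Y)
    have h2 := blockMean_tilt_sub_le hβ hW'.1 hwS f η (hb w) (h _ hW' w hwS)
    have e : (fun σ : V → Bool => W σ * Real.exp (2 * β * ∑ y ∈ insert w Y, spin (σ y))) =
        fun σ => W σ * Real.exp (2 * β * ∑ y ∈ Y, spin (σ y)) *
          Real.exp (2 * β * spin (σ w)) := by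
      ext σ
      rw [Finset.sum_insert hw, mul_assoc (W σ), ← Real.exp_add]
      congr 2; ring
    rw [e, Finset.sum_insert hw]
    linarith

/-- Flipping `u` acts on the block only as a field on its neighbours in `S`; neighbours outside `S`
are frozen and contribute the constant factor `D`, which cancels. -/
lemma blockMean_update_true_eq {S : Finset V} {u v : V} (hu : u ∉ S) (huv : u ≠ v)
    (hW : IsIsingWeight G β W) (η : V → Bool) :
    blockMean W S (fun σ => spin (σ v)) (Function.update η u true) =
      blockMean (fun σ => W σ *
        Real.exp (2 * β * ∑ y ∈ G.neighborFinset u ∩ S, spin (σ y))) S (fun σ => spin (σ v))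
        (Function.update η u false) := by
  obtain ⟨C, hC, h⟩ := hW.2 u
  set D := C * Real.exp (2 * β * ∑ y ∈ G.neighborFinset u \ S, spin (η y)) with hD
  have hD0 : 0 < D := by positivity
  have h1 : ∀ s b, resample S s (Function.update η u b) =
      Function.update (resample S s η) u b := by
    intro s b; ext x; by_cases hx : x = u
    · subst hx; simp [resample, hu]
    · by_cases hxS : x ∈ S <;> simp [resample, hx, hxS]
  have hne : ∀ y ∈ G.neighborFinset u, y ≠ u := by
    rintro y hy rfl; simp at hy
  have h2 : ∀ s, W (resample S s (Function.update η u true)) =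
      D * (W (resample S s (Function.update η u false)) * Real.exp (2 * β *
        ∑ y ∈ G.neighborFinset u ∩ S, spin (resample S s (Function.update η u false) y))) := by
    intro s
    rw [h1, h1, h, hD, ← Finset.sum_inter_add_sum_sdiff _ S, mul_add, Real.exp_add]
    have a1 : ∑ y ∈ G.neighborFinset u ∩ S, spin (resample S s η y) =
        ∑ y ∈ G.neighborFinset u ∩ S, spin (Function.update (resample S s η) u false y) :=
      Finset.sum_congr rfl fun y hy => by
        rw [Function.update_of_ne (hne y (Finset.mem_inter.1 hy).1)]
    have a2 : ∑ y ∈ G.neighborFinset u \ S, spin (resample S s η y) =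
        ∑ y ∈ G.neighborFinset u \ S, spin (η y) :=
      Finset.sum_congr rfl fun y hy => by simp [resample, (Finset.mem_sdiff.1 hy).2]
    rw [a1, a2]; ring
  have e1 : ∀ g : (V → Bool) → ℝ, (∀ σ, g (Function.update σ u true) = g (Function.update σ u false)) →
      avg S (W * g) (Function.update η u true) = D * avg S ((fun σ => W σ *
        Real.exp (2 * β * ∑ y ∈ G.neighborFinset u ∩ S, spin (σ y))) * g)
        (Function.update η u false) := by
    intro g hg
    rw [← avg_smul]
    refine avg_congr fun s => ?_
    simp only [Pi.mul_apply, Pi.smul_apply, smul_eq_mul]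
    rw [h2, show g (resample S s (Function.update η u true)) =
      g (resample S s (Function.update η u false)) by rw [h1, h1, hg]]
    ring
  have e2 := e1 1 (fun _ => rfl)
  rw [mul_one, mul_one] at e2
  unfold blockMean
  rw [e1 _ (by intro σ; simp [Function.update_of_ne huv.symm]), e2,
    mul_div_mul_left _ _ hD0.ne']

lemma blockMean_update_self {S : Finset V} {v : V} (hv : v ∉ S) (hW : ∀ σ, 0 < W σ)
    (η : V → Bool) (b : Bool) :
    blockMean W S (fun σ => spin (σ v)) (Function.update η v b) = spin b := by
  refine le_antisymm (blockMean_le hW fun s => ?_) (le_blockMean hW fun s => ?_) <;>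
    simp [resample, hv]

/-- The influence of a pinned spin at `u` on the spin at `v` is bounded by the generating function
of non-backtracking walks. -/
theorem blockMean_update_sub_le (hβ : 0 ≤ β) (v : V) (n : ℕ) :
    ∀ (S : Finset V), S.card = n → ∀ (p u : V), p ∉ S → u ∉ S → ∀ W, IsIsingWeight G β W → ∀ η,
      blockMean W S (fun σ => spin (σ v)) (Function.update η u true) -
        blockMean W S (fun σ => spin (σ v)) (Function.update η u false) ≤
      2 * ∑ k ∈ Finset.range (n + 1), Real.tanh β ^ k * nbWalks G v k p u := by
  have ht := tanh_nonneg hβ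
  induction n with
  | zero =>
    intro S hS p u _ hu W hW η
    obtain rfl := Finset.card_eq_zero.1 hS
    by_cases huv : u = v
    · subst huv
      rw [blockMean_update_self hu hW.1, blockMean_update_self hu hW.1]
      simp [spin, nbWalks]; norm_num
    · rw [blockMean_update_true_eq hu huv hW]
      simp [nbWalks, huv]
  | succ n ih =>
    intro S hS p u hp hu W hW η
    rw [Finset.sum_range_succ']
    by_cases huv : u = v
    · subst huv
      rw [blockMean_update_self hu hW.1, blockMean_update_self hu hW.1]
      have : 0 ≤ ∑ k ∈ Finset.range (n + 1), Real.tanh β ^ (k + 1) * nbWalks G u (k + 1) p u :=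
        Finset.sum_nonneg fun k _ => mul_nonneg (pow_nonneg ht _) (nbWalks_nonneg _ _ _ _)
      have h0 : nbWalks G u 0 p u = 1 := if_pos rfl
      simp only [spin, h0, if_true, Bool.false_eq_true, if_false, pow_zero]
      linarith
    · rw [blockMean_update_true_eq hu huv hW]
      have hb : ∀ w, 0 ≤ 2 * ∑ k ∈ Finset.range (n + 1), Real.tanh β ^ k * nbWalks G v k u w :=
        fun w => mul_nonneg zero_le_two
          (Finset.sum_nonneg fun k _ => mul_nonneg (pow_nonneg ht _) (nbWalks_nonneg _ _ _ _))
      -- Each neighbour `w` in `S` is pinned in turn and leaves the block. Since `u` lies outside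
      -- the block, it becomes the forbidden predecessor `p` of `w`.
      have h1 := blockMean_tilt_sum_sub_le hβ (G := G) (S := S) (fun σ => spin (σ v))
        (Function.update η u false) hb (fun W' hW' w hw => ih (S.erase w)
          (by rw [Finset.card_erase_of_mem hw, hS]; rfl) u w
          (fun h => hu (Finset.mem_of_mem_erase h)) (Finset.notMem_erase w S) W' hW' _) hW
        (Y := G.neighborFinset u ∩ S) Finset.inter_subset_right
      refine h1.trans ?_
      have h2 : ∑ w ∈ G.neighborFinset u ∩ S,
          2 * ∑ k ∈ Finset.range (n + 1), Real.tanh β ^ k * nbWalks G v k u w ≤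
          ∑ w ∈ (G.neighborFinset u).erase p,
          2 * ∑ k ∈ Finset.range (n + 1), Real.tanh β ^ k * nbWalks G v k u w := by
        refine Finset.sum_le_sum_of_subset_of_nonneg (fun w hw => ?_) fun w _ _ => hb w
        rw [Finset.mem_inter] at hw
        exact Finset.mem_erase.2 ⟨fun h => hp (h ▸ hw.2), hw.1⟩
      refine (mul_le_mul_of_nonneg_left h2 ht).trans (le_of_eq ?_)
      simp only [nbWalks, huv, if_false, mul_zero, add_zero, Finset.mul_sum]
      rw [Finset.sum_comm]
      refine Finset.sum_congr rfl fun k _ => Finset.sum_congr rfl fun w _ => ?_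
      ring

end Influence

/-! ### Ball sizes and walk counts -/

section Balls

variable {V : Type*} [Fintype V] [DecidableEq V] (G : SimpleGraph V) [DecidableRel G.Adj]

/-- The ball of radius `r` around `v` in the graph distance. -/
def graphBall (v : V) : ℕ → Finset V
  | 0 => {v}
  | r + 1 => graphBall v r ∪ (graphBall v r).biUnion fun w => G.neighborFinset w

variable {G}

lemma mem_graphBall_succ {u v : V} {r : ℕ} :
    u ∈ graphBall G v (r + 1) ↔ ∃ w ∈ graphBall G v r, u = w ∨ G.Adj w u := by
  simp only [graphBall, Finset.mem_union, Finset.mem_biUnion, SimpleGraph.mem_neighborFinset]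
  constructor
  · rintro (h | ⟨w, hw, h⟩)
    · exact ⟨u, h, Or.inl rfl⟩
    · exact ⟨w, hw, Or.inr h⟩
  · rintro ⟨w, hw, rfl | h⟩
    · exact Or.inl hw
    · exact Or.inr ⟨w, hw, h⟩

lemma graphBall_mono (v : V) : Monotone (graphBall G v) :=
  monotone_nat_of_le_succ fun _ => Finset.subset_union_left

lemma mem_graphBall_self (v : V) (r : ℕ) : v ∈ graphBall G v r :=
  graphBall_mono v (Nat.zero_le r) (Finset.mem_singleton_self v)

lemma mem_graphBall_succ_of_near {u v w : V} {r : ℕ} (hw : v = w ∨ G.Adj w v)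
    (h : u ∈ graphBall G w r) : u ∈ graphBall G v (r + 1) := by
  induction r generalizing u with
  | zero =>
    rw [graphBall, Finset.mem_singleton] at h
    subst h
    refine mem_graphBall_succ.2 ⟨v, Finset.mem_singleton_self v, ?_⟩
    rcases hw with h | h
    · exact Or.inl h.symm
    · exact Or.inr h.symm
  | succ r ih =>
    obtain ⟨x, hx, h⟩ := mem_graphBall_succ.1 h
    exact mem_graphBall_succ.2 ⟨x, ih hx, h⟩

lemma mem_graphBall_symm {u v : V} {r : ℕ} (h : u ∈ graphBall G v r) : v ∈ graphBall G u r := by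
  induction r generalizing u with
  | zero =>
    rw [graphBall, Finset.mem_singleton] at h ⊢
    exact h.symm
  | succ r ih =>
    obtain ⟨w, hw, h⟩ := mem_graphBall_succ.1 h
    exact mem_graphBall_succ_of_near h (ih hw)

lemma card_graphBall_le {d : ℕ} (hd : G.maxDegree ≤ d) (v : V) (r : ℕ) :
    (graphBall G v r).card ≤ (d + 1) ^ r := by
  induction r with
  | zero => simp [graphBall]
  | succ r ih =>
    calc _ ≤ (graphBall G v r).card + (graphBall G v r).card * d := by
          refine (Finset.card_union_le _ _).trans (Nat.add_le_add_left ?_ _)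
          refine Finset.card_biUnion_le_card_mul _ _ _ fun w _ => ?_
          rw [SimpleGraph.card_neighborFinset_eq_degree]
          exact (G.degree_le_maxDegree w).trans hd
      _ = (graphBall G v r).card * (d + 1) := by ring
      _ ≤ _ := by rw [pow_succ]; exact Nat.mul_le_mul_right _ ih

lemma nbWalks_eq_zero {v : V} {k : ℕ} {p u : V} (h : u ∉ graphBall G v k) :
    nbWalks G v k p u = 0 := by
  induction k generalizing p u with
  | zero =>
    rw [graphBall, Finset.mem_singleton] at h
    exact if_neg h
  | succ k ih =>
    refine Finset.sum_eq_zero fun w hw => ih fun hw' => h ?_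
    have : G.Adj u w := by simpa using Finset.mem_of_mem_erase hw
    exact mem_graphBall_succ.2 ⟨w, hw', Or.inr this.symm⟩

lemma sum_nbWalks_le {d : ℕ} (hd : G.maxDegree ≤ d) (k : ℕ) {p u : V} (h : G.Adj u p) :
    ∑ v, nbWalks G v k p u ≤ ((d - 1 : ℕ) : ℝ) ^ k := by
  induction k generalizing p u with
  | zero => simp [nbWalks]
  | succ k ih =>
    simp only [nbWalks]
    rw [Finset.sum_comm]
    have hcard : ((G.neighborFinset u).erase p).card ≤ d - 1 := by
      rw [Finset.card_erase_of_mem (by simpa using h), SimpleGraph.card_neighborFinset_eq_degree]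
      exact Nat.sub_le_sub_right ((G.degree_le_maxDegree u).trans hd) 1
    calc _ ≤ ∑ _w ∈ (G.neighborFinset u).erase p, ((d - 1 : ℕ) : ℝ) ^ k := by
          refine Finset.sum_le_sum fun w hw => ih ?_
          have : G.Adj u w := by simpa using Finset.mem_of_mem_erase hw
          exact this.symm
      _ ≤ _ := by
          rw [Finset.sum_const, nsmul_eq_mul, pow_succ']
          gcongr

/-- With `p = u` the first step is unrestricted, as `u` is not its own neighbour; this costs one
factor `d` in place of `d - 1`. -/
lemma sum_nbWalks_self_le {d : ℕ} (hd : G.maxDegree ≤ d) (k : ℕ) (u : V) :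
    ∑ v, nbWalks G v (k + 1) u u ≤ d * ((d - 1 : ℕ) : ℝ) ^ k := by
  simp only [nbWalks]
  rw [Finset.sum_comm]
  have hcard : ((G.neighborFinset u).erase u).card ≤ d := by
    refine (Finset.card_le_card (Finset.erase_subset _ _)).trans ?_
    rw [SimpleGraph.card_neighborFinset_eq_degree]
    exact (G.degree_le_maxDegree u).trans hd
  calc _ ≤ ∑ _w ∈ (G.neighborFinset u).erase u, ((d - 1 : ℕ) : ℝ) ^ k := by
        refine Finset.sum_le_sum fun w hw => sum_nbWalks_le hd k ?_
        have : G.Adj u w := by simpa using Finset.mem_of_mem_erase hw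
        exact this.symm
    _ ≤ _ := by
        rw [Finset.sum_const, nsmul_eq_mul]
        gcongr

end Balls

/-! ### Sensitivity of the censored dynamics to one spin -/

section Sensitivity

variable {V : Type*} [Fintype V] [DecidableEq V] (G : SimpleGraph V) [DecidableRel G.Adj]

/-- A bound for the effect of the spin at `u` on the expected spin at `v` after `T` updates of
the ball of radius `R` around `v`. -/
noncomputable def sensitivity (β : ℝ) (d R T : ℕ) (u v : V) : ℝ :=
  (if u ∈ graphBall G v (R + 1) then
    4 * (1 - Real.exp (-2 * β) ^ (d * (d + 1) ^ R)) ^ T else 0) +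
  2 * ∑ k ∈ Finset.Ico (R + 1) (Fintype.card V + 1), Real.tanh β ^ k * nbWalks G v k u u

variable {G} {β : ℝ}

lemma sub_exp_pow_nonneg (hβ : 0 ≤ β) (m : ℕ) : 0 ≤ 1 - Real.exp (-2 * β) ^ m :=
  sub_nonneg.2 (pow_le_one₀ (Real.exp_pos _).le (Real.exp_le_one_iff.2 (by linarith)))

lemma localDynamics_pow_update_sub_le (hβ : 0 ≤ β) {d : ℕ} (hd : G.maxDegree ≤ d) (R T : ℕ)
    (u v : V) (σ : V → Bool) :
    (localDynamics G β (graphBall G v R) ^ T) (fun σ => spin (σ v)) (Function.update σ u true) -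
      (localDynamics G β (graphBall G v R) ^ T) (fun σ => spin (σ v))
        (Function.update σ u false) ≤ sensitivity G β d R T u v := by
  set A := graphBall G v R with hA
  set F := (localDynamics G β A ^ T) (fun σ => spin (σ v)) with hF
  have ht := tanh_nonneg hβ
  have hosc : ∀ σ τ : V → Bool, (∀ w ∉ A, σ w = τ w) → spin (σ v) - spin (τ v) ≤ 2 := by
    intro σ τ _
    cases σ v <;> cases τ v <;> norm_num [spin]
  have hδ : (1 - Real.exp (-2 * β) ^ (d * A.card)) ^ T ≤
      (1 - Real.exp (-2 * β) ^ (d * (d + 1) ^ R)) ^ T := by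
    refine pow_le_pow_left₀ (sub_exp_pow_nonneg hβ _) (sub_le_sub_left ?_ 1) T
    exact pow_le_pow_of_le_one (Real.exp_pos _).le (Real.exp_le_one_iff.2 (by linarith))
      (Nat.mul_le_mul_left d (card_graphBall_le hd v R))
  have h0 : 0 ≤ (1 - Real.exp (-2 * β) ^ (d * (d + 1) ^ R)) ^ T :=
    pow_nonneg (sub_exp_pow_nonneg hβ _) T
  have hsum0 : 0 ≤ ∑ k ∈ Finset.Ico (R + 1) (Fintype.card V + 1),
      Real.tanh β ^ k * nbWalks G v k u u :=
    Finset.sum_nonneg fun k _ => mul_nonneg (pow_nonneg ht _) (nbWalks_nonneg _ _ _ _)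
  unfold sensitivity
  by_cases hu : u ∈ A
  -- Inside the ball, the dependence on the initial spin at `u` is forgotten by the Doeblin
  -- contraction.
  · rw [if_pos (graphBall_mono v (Nat.le_succ R) hu)]
    have := localDynamics_pow_sub_le (G := G) hβ hd hosc T
      (σ := Function.update σ u true) (τ := Function.update σ u false)
      fun w hw => by
        have : w ≠ u := fun h => hw (h ▸ hu)
        simp [Function.update_of_ne this]
    linarith
  by_cases hu' : u ∈ graphBall G v (R + 1)
  · rw [if_pos hu']
    -- On the boundary, both starting points are compared with their equilibria: two errors of `2 *
    -- (1 - δ) ^ T` give the constant `4`, and the equilibria differ by the walk sum.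
    have h1 := abs_le.1 (abs_localDynamics_pow_sub_blockMean_le (G := G) hβ hd hosc T
      (Function.update σ u true))
    have h2 := abs_le.1 (abs_localDynamics_pow_sub_blockMean_le (G := G) hβ hd hosc T
      (Function.update σ u false))
    have h3 := blockMean_update_sub_le hβ v A.card A rfl u u hu hu _ isIsingWeight_weight σ
      (G := G)
    have h4 : ∑ k ∈ Finset.range (A.card + 1), Real.tanh β ^ k * nbWalks G v k u u ≤
        ∑ k ∈ Finset.Ico (R + 1) (Fintype.card V + 1), Real.tanh β ^ k * nbWalks G v k u u := by
      calc _ ≤ ∑ k ∈ Finset.range (Fintype.card V + 1), Real.tanh β ^ k * nbWalks G v k u u := by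
            refine Finset.sum_le_sum_of_subset_of_nonneg
              (Finset.range_mono (Nat.add_le_add_right (Finset.card_le_univ A) 1)) ?_
            exact fun k _ _ => mul_nonneg (pow_nonneg ht _) (nbWalks_nonneg _ _ _ _)
        _ ≤ _ := by
            -- Walks of length at most `R` cannot join `v` to a vertex outside the ball, so the sum
            -- starts at `R + 1`.
            refine le_of_eq (Finset.sum_subset (fun k hk => ?_) fun k hk hk' => ?_).symm
            · exact Finset.mem_range.2 (Finset.mem_Ico.1 hk).2
            · rw [nbWalks_eq_zero, mul_zero]
              intro h
              refine hu (graphBall_mono v ?_ h)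
              rw [Finset.mem_range] at hk
              rw [Finset.mem_Ico] at hk'
              omega
    linarith
  · rw [if_neg hu']
    have : F (Function.update σ u true) = F (Function.update σ u false) := by
      refine localDynamics_pow_congr (B := graphBall G v (R + 1))
        (graphBall_mono v (Nat.le_succ R)) (fun w hw y hy => mem_graphBall_succ.2 ⟨w, hw, Or.inr hy⟩)
        (fun σ τ h => by rw [h v (mem_graphBall_self v _)]) T fun w hw => ?_
      have : w ≠ u := fun h => hu' (h ▸ hw)
      simp [Function.update_of_ne this]
    rw [this]; linarith

lemma sum_sensitivity_le (hβ : 0 ≤ β) {d : ℕ} (hd : G.maxDegree ≤ d) (R T : ℕ)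
    (hq : ((d - 1 : ℕ) : ℝ) * Real.tanh β < 1) (u : V) :
    ∑ v, sensitivity G β d R T u v ≤
      (d + 1) ^ (R + 1) * (4 * (1 - Real.exp (-2 * β) ^ (d * (d + 1) ^ R)) ^ T) +
      2 * (d * Real.tanh β * ((((d - 1 : ℕ) : ℝ) * Real.tanh β) ^ R /
        (1 - ((d - 1 : ℕ) : ℝ) * Real.tanh β))) := by
  have ht := tanh_nonneg hβ
  have h0 : 0 ≤ (1 - Real.exp (-2 * β) ^ (d * (d + 1) ^ R)) ^ T :=
    pow_nonneg (sub_exp_pow_nonneg hβ _) T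
  unfold sensitivity
  rw [Finset.sum_add_distrib]
  refine add_le_add ?_ ?_
  · rw [← Finset.sum_filter, Finset.sum_const, nsmul_eq_mul]
    refine mul_le_mul_of_nonneg_right ?_ (by linarith)
    have : (Finset.univ.filter fun v => u ∈ graphBall G v (R + 1)) ⊆ graphBall G u (R + 1) :=
      fun v hv => mem_graphBall_symm (Finset.mem_filter.1 hv).2
    exact_mod_cast (Finset.card_le_card this).trans (card_graphBall_le hd u (R + 1))
  · rw [← Finset.mul_sum, Finset.sum_comm]
    refine mul_le_mul_of_nonneg_left ?_ zero_le_two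
    calc _ ≤ ∑ k ∈ Finset.Ico R (Fintype.card V),
          d * Real.tanh β * (((d - 1 : ℕ) : ℝ) * Real.tanh β) ^ k := by
          rw [← Finset.sum_Ico_add' _ R (Fintype.card V) 1]
          refine Finset.sum_le_sum fun k _ => ?_
          rw [← Finset.mul_sum]
          refine (mul_le_mul_of_nonneg_left (sum_nbWalks_self_le hd k u)
            (pow_nonneg ht _)).trans (le_of_eq ?_)
          rw [mul_pow]; ring
      _ ≤ _ := by
          rw [← Finset.mul_sum]
          refine mul_le_mul_of_nonneg_left ?_ (by positivity)
          exact geom_sum_Ico_le_of_lt_one (by positivity) hq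

/-- Suitable block radii and burn-in times exist below the uniqueness threshold. -/
lemma exists_sum_sensitivity_le_one (hβ : 0 ≤ β) (d : ℕ)
    (hq : ((d - 1 : ℕ) : ℝ) * Real.tanh β < 1) :
    ∃ R T : ℕ, 0 < T ∧ ∀ (V : Type*) [Fintype V] [DecidableEq V] (G : SimpleGraph V)
      [DecidableRel G.Adj], G.maxDegree ≤ d → ∀ u, ∑ v, sensitivity G β d R T u v ≤ 1 := by
  have ht := tanh_nonneg hβ
  set q := ((d - 1 : ℕ) : ℝ) * Real.tanh β with hqdef
  have hq0 : 0 ≤ q := by positivity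
  have l1 : Filter.Tendsto (fun R : ℕ => 2 * (d * Real.tanh β * (q ^ R / (1 - q))))
      Filter.atTop (nhds (2 * (d * Real.tanh β * (0 / (1 - q))))) :=
    (((tendsto_pow_atTop_nhds_zero_of_lt_one hq0 hq).div_const _).const_mul _).const_mul _
  simp only [zero_div, mul_zero] at l1
  -- The radius comes first, making the walk tail at most `1/2`; `T` then beats the ball volume at
  -- this fixed radius.
  obtain ⟨R, hR⟩ := (l1.eventually_le_const (show (0 : ℝ) < 1 / 2 by norm_num)).exists
  set δ := Real.exp (-2 * β) ^ (d * (d + 1) ^ R) with hδ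
  have hδ0 : 0 < δ := by positivity
  have l2 : Filter.Tendsto (fun T : ℕ => ((d : ℝ) + 1) ^ (R + 1) * (4 * (1 - δ) ^ T))
      Filter.atTop (nhds (((d : ℝ) + 1) ^ (R + 1) * (4 * 0))) :=
    ((tendsto_pow_atTop_nhds_zero_of_lt_one (sub_exp_pow_nonneg hβ _)
      (by linarith)).const_mul _).const_mul _
  simp only [mul_zero] at l2
  obtain ⟨T, hT, hT0⟩ := ((l2.eventually_le_const (show (0 : ℝ) < 1 / 2 by norm_num)).and
    (Filter.eventually_gt_atTop 0)).exists
  refine ⟨R, T, hT0, fun V _ _ G _ hd u => ?_⟩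
  have := sum_sensitivity_le hβ hd R T hq u
  linarith

lemma monotone_of_update_le {g : (V → Bool) → ℝ}
    (h : ∀ u σ, g (Function.update σ u false) ≤ g (Function.update σ u true)) : Monotone g := by
  intro σ τ hστ
  have key : ∀ S : Finset V, g σ ≤ g (resample S τ σ) := by
    intro S
    induction S using Finset.induction_on with
    | empty => simp
    | insert u S hu ih =>
      refine ih.trans ?_
      have e1 : resample (insert u S) τ σ = Function.update (resample S τ σ) u (τ u) := by
        ext v; by_cases hv : v = u
        · subst hv; simp [resample]
        · simp [resample, hv]
      have e2 : resample S τ σ = Function.update (resample S τ σ) u (σ u) := by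
        ext v; by_cases hv : v = u
        · subst hv; simp [resample, hu]
        · simp [hv]
      rw [e1]
      conv_lhs => rw [e2]
      have := hστ u
      revert this
      cases σ u <;> cases τ u
      · simp
      · intro _; exact h u _
      · simp
      · simp
  have := key Finset.univ
  rwa [show resample Finset.univ τ σ = τ by ext v; simp [resample]] at this

/-- A spin jumps by `2`, so weights `l u / 2` compensate every increment of `f`. This brings
arbitrary observables within reach of monotonicity. -/
lemma monotone_sum_sub {f : (V → Bool) → ℝ} {l : V → ℝ}
    (h : ∀ u σ, f (Function.update σ u true) - f (Function.update σ u false) ≤ l u) :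
    Monotone ((∑ u, (l u / 2) • fun σ : V → Bool => spin (σ u)) - f) := by
  refine monotone_of_update_le fun u σ => ?_
  have : ∀ b, ((∑ w, (l w / 2) • fun σ : V → Bool => spin (σ w)) - f) (Function.update σ u b) =
      ∑ w ∈ Finset.univ.erase u, l w / 2 * spin (σ w) + l u / 2 * spin b -
        f (Function.update σ u b) := by
    intro b
    simp only [Pi.sub_apply, Finset.sum_apply, Pi.smul_apply, smul_eq_mul]
    rw [← Finset.sum_erase_add _ _ (Finset.mem_univ u)]
    simp only [Function.update_self]
    congr 2
    refine Finset.sum_congr rfl fun w hw => ?_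
    rw [Function.update_of_ne (Finset.ne_of_mem_erase hw)]
  rw [this, this]
  have := h u σ
  simp only [spin, if_true, Bool.false_eq_true, if_false]
  linarith

lemma spin_mono (v : V) : Monotone fun σ : V → Bool => spin (σ v) := by
  intro σ τ h
  have := h v
  revert this
  dsimp only
  cases σ v <;> cases τ v <;> simp [spin]

end Sensitivity

/-! ### Contraction of the summed spin gap -/

section Contraction

variable {V : Type*} [Fintype V] [DecidableEq V] (G : SimpleGraph V) [DecidableRel G.Adj]

/-- The difference of the expected spins at `v` after `t` steps of the Isolated-vertex dynamics
from the all-plus and the all-minus configuration. -/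
noncomputable def spinGap (β : ℝ) (t : ℕ) (v : V) : ℝ :=
  (localDynamics G β Finset.univ ^ t) (fun σ => spin (σ v)) ⊤ -
    (localDynamics G β Finset.univ ^ t) (fun σ => spin (σ v)) ⊥

variable {G} {β : ℝ}

lemma spinGap_nonneg (hβ : 0 ≤ β) (t : ℕ) (v : V) : 0 ≤ spinGap G β t v :=
  sub_nonneg.2 (localDynamics_pow_mono hβ _ t (spin_mono v) bot_le)

lemma localDynamics_pow_top_sub_bot_le (hβ : 0 ≤ β) (t : ℕ) {f : (V → Bool) → ℝ} {l : V → ℝ}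
    (h : ∀ u σ, f (Function.update σ u true) - f (Function.update σ u false) ≤ l u) :
    (localDynamics G β Finset.univ ^ t) f ⊤ - (localDynamics G β Finset.univ ^ t) f ⊥ ≤
      ∑ u, l u / 2 * spinGap G β t u := by
  have := localDynamics_pow_mono (G := G) hβ Finset.univ t (monotone_sum_sub h)
    (bot_le : (⊥ : V → Bool) ≤ ⊤)
  simp only [map_sub, map_sum, map_smul, Pi.sub_apply, Finset.sum_apply, Pi.smul_apply,
    smul_eq_mul] at this
  simp only [spinGap, mul_sub, Finset.sum_sub_distrib]
  linarith

/-- For each `v` a different ball is censored. The sensitivities summed over `v` are at most `1`,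
and the factor `1/2` is that of `monotone_sum_sub`. -/
lemma sum_spinGap_add_le (hβ : 0 ≤ β) {d R T : ℕ} (hd : G.maxDegree ≤ d)
    (hs : ∀ u, ∑ v, sensitivity G β d R T u v ≤ 1) (t : ℕ) :
    ∑ v, spinGap G β (t + T) v ≤ (∑ v, spinGap G β t v) / 2 := by
  calc _ ≤ ∑ v, ∑ u, sensitivity G β d R T u v / 2 * spinGap G β t u := by
        refine Finset.sum_le_sum fun v _ => ?_
        refine le_trans (sub_le_sub
          (localDynamics_pow_add_top_le hβ (graphBall G v R) t T (spin_mono v))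
          (localDynamics_pow_add_bot_ge hβ (graphBall G v R) t T (spin_mono v))) ?_
        exact localDynamics_pow_top_sub_bot_le hβ t
          fun u σ => localDynamics_pow_update_sub_le hβ hd R T u v σ
    _ = ∑ u, (∑ v, sensitivity G β d R T u v) * (spinGap G β t u / 2) := by
        rw [Finset.sum_comm]
        refine Finset.sum_congr rfl fun u _ => ?_
        rw [Finset.sum_mul]
        exact Finset.sum_congr rfl fun v _ => by ring
    _ ≤ ∑ u, 1 * (spinGap G β t u / 2) := by
        refine Finset.sum_le_sum fun u _ => mul_le_mul_of_nonneg_right (hs u) ?_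
        exact div_nonneg (spinGap_nonneg hβ t u) zero_le_two
    _ = _ := by rw [Finset.sum_div]; simp

lemma sum_spinGap_mul_le (hβ : 0 ≤ β) {d R T : ℕ} (hd : G.maxDegree ≤ d)
    (hs : ∀ u, ∑ v, sensitivity G β d R T u v ≤ 1) (k : ℕ) :
    ∑ v, spinGap G β (k * T) v ≤ 2 * Fintype.card V / 2 ^ k := by
  induction k with
  | zero =>
    simp only [zero_mul, spinGap, pow_zero, Module.End.one_apply]
    simp [spin]
    linarith
  | succ k ih =>
    rw [Nat.succ_mul]
    refine (sum_spinGap_add_le hβ hd hs _).trans ?_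
    rw [pow_succ, ← div_div]
    linarith

/-- The oscillation of any observable is contracted by the total spin gap. -/
lemma localDynamics_pow_univ_sub_le (hβ : 0 ≤ β) (t : ℕ) {f : (V → Bool) → ℝ} {c : ℝ}
    (h : ∀ σ τ, f σ - f τ ≤ c) (σ τ : V → Bool) :
    (localDynamics G β Finset.univ ^ t) f σ - (localDynamics G β Finset.univ ^ t) f τ ≤
      c * ∑ v, spinGap G β t v := by
  have hc : 0 ≤ c := by simpa using h σ σ
  -- Compare both `τ` and `σ` with `⊤`, using `c/2` times the total spin minus `f` for `τ` and plus
  -- `f` for `σ`. The value of `f` at `⊤` cancels.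
  have g1 := localDynamics_pow_mono (G := G) hβ Finset.univ t
    (monotone_sum_sub (f := f) (l := fun _ => c) fun _ _ => h _ _) (le_top : τ ≤ ⊤)
  have g2 := localDynamics_pow_mono (G := G) hβ Finset.univ t
    (monotone_sum_sub (f := -f) (l := fun _ => c) fun u ρ => by
      have := h (Function.update ρ u false) (Function.update ρ u true)
      simp only [Pi.neg_apply]; linarith) (le_top : σ ≤ ⊤)
  have g3 : ∀ ρ, ∑ v, (localDynamics G β Finset.univ ^ t) (fun σ => spin (σ v)) ⊥ ≤
      ∑ v, (localDynamics G β Finset.univ ^ t) (fun σ => spin (σ v)) ρ := fun ρ =>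
    Finset.sum_le_sum fun v _ => localDynamics_pow_mono hβ _ t (spin_mono v) bot_le
  simp only [map_sub, map_neg, map_sum, map_smul, Pi.sub_apply, Pi.neg_apply, Finset.sum_apply,
    Pi.smul_apply, smul_eq_mul, ← Finset.mul_sum] at g1 g2
  simp only [spinGap, Finset.sum_sub_distrib]
  have h1 := mul_le_mul_of_nonneg_left (g3 σ) hc
  have h2 := mul_le_mul_of_nonneg_left (g3 τ) hc
  linarith

end Contraction

end Ising

/-- If the product reached `1` at `β`, the intermediate value theorem would give a solution in `[0,
β]`, contradicting the infimum. For `d = 0` the truncated `d - 1` is `0`. -/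
lemma mul_tanh_lt_one_of_lt_criticalBeta {d : ℕ} {β : ℝ} (hβ : 0 < β)
    (hβc : (β : EReal) < criticalBeta d) : ((d - 1 : ℕ) : ℝ) * Real.tanh β < 1 := by
  by_contra! h
  rcases Nat.eq_zero_or_pos d with rfl | hd
  · simp at h; linarith
  rw [Nat.cast_sub hd, Nat.cast_one] at h
  have hcont : ContinuousOn (fun b => ((d : ℝ) - 1) * Real.tanh b) (Set.Icc 0 β) := by
    have : Continuous Real.tanh := by
      simp only [funext Real.tanh_eq_sinh_div_cosh]
      exact Real.continuous_sinh.div Real.continuous_cosh fun x => (Real.cosh_pos x).ne'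
    fun_prop
  obtain ⟨b, hb, hb1⟩ := intermediate_value_Icc hβ.le hcont
    (show (1 : ℝ) ∈ Set.Icc _ _ from ⟨by simp, h⟩)
  have : criticalBeta d ≤ (b : EReal) := sInf_le ⟨b, hb1, rfl⟩
  exact absurd (hβc.trans_le this) (not_lt.2 (EReal.coe_le_coe_iff.2 hb.2))

namespace Ising

/-! ### Ergodicity, mixing time and spectral gap -/

section Convergence

variable {V : Type*} [Fintype V] [DecidableEq V] {G : SimpleGraph V} [DecidableRel G.Adj] {β : ℝ}

lemma isolatedVertexDynamics_pow_mulVec (t : ℕ) (f : (V → Bool) → ℝ) :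
    (isolatedVertexDynamics G β ^ t).mulVec f = (localDynamics G β Finset.univ ^ t) f := by
  rw [← toLin'_isolatedVertexDynamics, ← Matrix.toLin'_pow, Matrix.toLin'_apply]

lemma resampleProb_nonneg (F : Finset (Sym2 V)) (σ τ : V → Bool) : 0 ≤ resampleProb F σ τ :=
  Finset.prod_nonneg fun v _ => by split_ifs <;> norm_num

lemma percolationProb_nonneg (hβ : 0 ≤ β) (σ : V → Bool) (F : Finset (Sym2 V)) :
    0 ≤ percolationProb G β σ F := by
  have : Real.exp (-2 * β) ≤ 1 := Real.exp_le_one_iff.2 (by linarith)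
  exact mul_nonneg (pow_nonneg (by linarith) _) (by positivity)

lemma isolatedVertexDynamics_pos (hβ : 0 ≤ β) (σ τ : V → Bool) :
    0 < isolatedVertexDynamics G β σ τ := by
  refine Finset.sum_pos' (fun F _ => mul_nonneg (percolationProb_nonneg hβ σ F)
    (resampleProb_nonneg F σ τ)) ⟨∅, Finset.empty_mem_powerset _, ?_⟩
  refine mul_pos ?_ (Finset.prod_pos fun v _ => ?_)
  · simp only [percolationProb, Finset.card_empty, pow_zero, one_mul]
    positivity
  · rw [if_pos (by simp [IsIsolatedIn])]; norm_num

lemma isolatedVertexDynamics_mem_rowStochastic (hβ : 0 ≤ β) :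
    isolatedVertexDynamics G β ∈ Matrix.rowStochastic ℝ (V → Bool) := by
  refine Matrix.mem_rowStochastic.2 ⟨fun σ τ => (isolatedVertexDynamics_pos hβ σ τ).le, ?_⟩
  have := isolatedVertexDynamics_pow_mulVec (G := G) (β := β) 1 1
  rw [pow_one, pow_one] at this
  rw [this]
  exact localDynamics_const _ 1

lemma isErgodic_isolatedVertexDynamics (hβ : 0 ≤ β) :
    FiniteChain.IsErgodic (isolatedVertexDynamics G β) := by
  refine ⟨isolatedVertexDynamics_mem_rowStochastic hβ, fun σ τ => ⟨1, ?_⟩, fun σ k h => ?_⟩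
  · rw [pow_one]; exact isolatedVertexDynamics_pos hβ σ τ
  · exact Nat.dvd_one.1 (h 1 one_pos (by rw [pow_one]; exact isolatedVertexDynamics_pos hβ σ σ))

lemma sum_weight_mul_symm (f g : (V → Bool) → ℝ) :
    ∑ σ, weight G β σ * (isolatedVertexDynamics G β).mulVec f σ * g σ =
      ∑ σ, weight G β σ * f σ * (isolatedVertexDynamics G β).mulVec g σ := by
  have := isolatedVertexDynamics_pow_mulVec (G := G) (β := β) 1
  simp only [pow_one] at this
  simp only [this]
  exact sum_weight_mul_localDynamics_symm _ f g

lemma isReversible_isolatedVertexDynamics :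
    FiniteChain.IsReversible (isolatedVertexDynamics G β) (gibbs G β) := by
  intro σ τ
  have := sum_weight_mul_symm (G := G) (β := β) (Pi.single τ 1) (Pi.single σ 1)
  simp only [Matrix.mulVec_single_one, Matrix.col_apply, Pi.single_apply, mul_ite, mul_one,
    mul_zero, ite_mul, zero_mul, Finset.sum_ite_eq', Finset.mem_univ, if_true] at this
  simp only [gibbs, div_mul_eq_mul_div, this]

lemma partitionFunction_pos : 0 < partitionFunction G β :=
  Finset.sum_pos (fun σ _ => weight_pos σ) Finset.univ_nonempty

lemma gibbs_nonneg (σ : V → Bool) : 0 ≤ gibbs G β σ :=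
  div_nonneg (weight_pos σ).le partitionFunction_pos.le

lemma sum_gibbs : ∑ σ, gibbs G β σ = 1 := by
  simp only [gibbs, ← Finset.sum_div]
  exact div_self partitionFunction_pos.ne'

lemma sum_gibbs_mul_localDynamics_pow (t : ℕ) (f : (V → Bool) → ℝ) :
    ∑ σ, gibbs G β σ * (localDynamics G β Finset.univ ^ t) f σ = ∑ σ, gibbs G β σ * f σ := by
  have h1 : (localDynamics G β Finset.univ ^ t) 1 = 1 := by
    induction t with
    | zero => simp
    | succ t ih =>
      rw [pow_succ', Module.End.mul_apply, ih]
      exact localDynamics_const _ 1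
  have h := sum_weight_mul_localDynamics_pow_symm (G := G) (β := β) Finset.univ t f 1
  rw [h1] at h
  simp only [Pi.one_apply, mul_one] at h
  simp only [gibbs, div_mul_eq_mul_div, ← Finset.sum_div, h]

lemma tvDist_isolatedVertexDynamics_le (hβ : 0 ≤ β) (t : ℕ) (σ : V → Bool) :
    FiniteChain.tvDist ((isolatedVertexDynamics G β ^ t) σ) (gibbs G β) ≤
      ∑ v, spinGap G β t v := by
  classical
  set μ := (isolatedVertexDynamics G β ^ t) σ with hμ
  -- The indicator of the event attaining the total variation distance.
  let f : (V → Bool) → ℝ := fun τ => if gibbs G β τ ≤ μ τ then 1 else 0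
  have hmul : ∀ g : (V → Bool) → ℝ,
      ∑ τ, μ τ * g τ = (localDynamics G β Finset.univ ^ t) g σ := by
    intro g
    rw [← isolatedVertexDynamics_pow_mulVec]; rfl
  have hμ1 : ∑ τ, μ τ = 1 := by
    have h := pow_mem (isolatedVertexDynamics_mem_rowStochastic (G := G) hβ) t
    have := congrFun (Matrix.mem_rowStochastic.1 h).2 σ
    simpa [Matrix.mulVec, dotProduct] using this
  have h1 : FiniteChain.tvDist μ (gibbs G β) = ∑ τ, μ τ * f τ - ∑ τ, gibbs G β τ * f τ := by
    have e : ∀ τ, |μ τ - gibbs G β τ| =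
        2 * (μ τ * f τ - gibbs G β τ * f τ) - (μ τ - gibbs G β τ) := by
      intro τ
      by_cases h : gibbs G β τ ≤ μ τ
      · simp only [f, h, if_true]; rw [abs_of_nonneg (sub_nonneg.2 h)]; ring
      · simp only [f, h, if_false]; rw [abs_of_neg (sub_neg.2 (not_le.1 h))]; ring
    simp only [FiniteChain.tvDist, e, Finset.sum_sub_distrib, ← Finset.mul_sum, hμ1, sum_gibbs]
    ring
  rw [h1, hmul, ← sum_gibbs_mul_localDynamics_pow t f]
  set P := localDynamics G β Finset.univ ^ t
  calc P f σ - ∑ τ, gibbs G β τ * P f τ = ∑ τ, gibbs G β τ * (P f σ - P f τ) := by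
        simp only [mul_sub, Finset.sum_sub_distrib, ← Finset.sum_mul, sum_gibbs, one_mul]
    _ ≤ ∑ τ, gibbs G β τ * (1 * ∑ v, spinGap G β t v) := by
        refine Finset.sum_le_sum fun τ _ => mul_le_mul_of_nonneg_left ?_ (gibbs_nonneg τ)
        refine localDynamics_pow_univ_sub_le hβ t (fun x y => ?_) σ τ
        simp only [f]; split_ifs <;> norm_num
    _ = _ := by rw [← Finset.sum_mul, sum_gibbs, one_mul, one_mul]

/-- An eigenvector for `l ≠ 1` is not constant, and `t` steps multiply its oscillation by `|l| ^ t`.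
-/
lemma abs_pow_le_sum_spinGap (hβ : 0 ≤ β) (t : ℕ) {l : ℝ}
    (hl : Module.End.HasEigenvalue (Matrix.toLin' (isolatedVertexDynamics G β)) l) (h1 : l ≠ 1) :
    |l| ^ t ≤ ∑ v, spinGap G β t v := by
  rw [toLin'_isolatedVertexDynamics] at hl
  obtain ⟨f, hf⟩ := hl.exists_hasEigenvector
  have hpow := hf.pow_apply t
  obtain ⟨x, hx⟩ := Finite.exists_max f
  obtain ⟨y, hy⟩ := Finite.exists_min f
  have hosc : 0 < f x - f y := by
    by_contra! h
    have hc : f = fun _ => f x := by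
      ext σ; exact le_antisymm (hx σ) (by linarith [hy σ])
    have h2 := hf.apply_eq_smul
    rw [hc, localDynamics_const] at h2
    have h3 := congrFun h2 x
    simp only [Pi.smul_apply, smul_eq_mul] at h3
    refine hf.2 ?_
    rw [hc]
    have h4 : (1 - l) * f x = 0 := by linarith
    rcases mul_eq_zero.1 h4 with h | h
    · exact absurd (by linarith) h1
    · ext; exact h
  have hb := localDynamics_pow_univ_sub_le (G := G) hβ t (f := f) (c := f x - f y)
    (fun σ τ => by linarith [hx σ, hy τ])
  simp only [hpow, Pi.smul_apply, smul_eq_mul] at hb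
  have a := hb x y
  have b := hb y x
  rw [← abs_pow]
  refine abs_le.2 ⟨?_, ?_⟩
  · by_contra! h
    nlinarith
  · by_contra! h
    nlinarith

lemma abs_eigenvalue_le (hβ : 0 ≤ β) {d R T : ℕ} (hT : 0 < T) (hd : G.maxDegree ≤ d)
    (hs : ∀ u, ∑ v, sensitivity G β d R T u v ≤ 1) {l : ℝ}
    (hl : Module.End.HasEigenvalue (Matrix.toLin' (isolatedVertexDynamics G β)) l) (h1 : l ≠ 1) :
    |l| ≤ 1 - 1 / (2 * T) := by
  have hT1 : (1 : ℝ) ≤ T := by exact_mod_cast hT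
  have h2 : 2 * |l| ^ T ≤ 1 := by
    by_contra! h
    -- Since `(2 * |l| ^ T) ^ k ≤ 2n` for every `k`, the base is at most `1`: the dependence on `n`
    -- disappears as `k` grows.
    obtain ⟨k, hk⟩ := pow_unbounded_of_one_lt (2 * Fintype.card V : ℝ) h
    have := (abs_pow_le_sum_spinGap hβ (k * T) hl h1).trans (sum_spinGap_mul_le hβ hd hs k)
    rw [le_div_iff₀ (by positivity), mul_comm k T, pow_mul] at this
    rw [mul_pow] at hk
    linarith
  by_contra! h
  -- Bernoulli's inequality: `(1 - 1/(2T)) ^ T ≥ 1/2`.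
  have h3 := one_add_mul_le_pow (a := -(1 / (2 * T : ℝ))) (by
    have : 1 / (2 * T : ℝ) ≤ 1 := by rw [div_le_one (by positivity)]; linarith
    linarith) T
  have h4 : (T : ℝ) * -(1 / (2 * T)) = -(1 / 2) := by field_simp
  have h5 : (1 + -(1 / (2 * T : ℝ))) ^ T < |l| ^ T := by
    refine pow_lt_pow_left₀ (by linarith) ?_ hT.ne'
    have : 1 / (2 * T : ℝ) ≤ 1 := by rw [div_le_one (by positivity)]; linarith
    linarith
  linarith

lemma relaxationTime_bounds (hβ : 0 ≤ β) {d R T : ℕ} (hT : 0 < T) (hd : G.maxDegree ≤ d)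
    (hs : ∀ u, ∑ v, sensitivity G β d R T u v ≤ 1) :
    1 ≤ FiniteChain.relaxationTime (isolatedVertexDynamics G β) ∧
      FiniteChain.relaxationTime (isolatedVertexDynamics G β) ≤ 2 * T := by
  have hT1 : (1 : ℝ) ≤ T := by exact_mod_cast hT
  have hle : 1 / (2 * T : ℝ) ≤ 1 := by rw [div_le_one (by positivity)]; linarith
  have h1 : FiniteChain.absSpectralGap (isolatedVertexDynamics G β) ≤ 1 := by
    refine sub_le_self _ (Real.sSup_nonneg ?_)
    rintro a ⟨l, -, -, rfl⟩
    exact abs_nonneg l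
  have h2 : 1 / (2 * T : ℝ) ≤ FiniteChain.absSpectralGap (isolatedVertexDynamics G β) := by
    unfold FiniteChain.absSpectralGap
    rw [le_sub_comm]
    refine Real.sSup_le ?_ (by linarith)
    rintro a ⟨l, hl, hl1, rfl⟩
    exact abs_eigenvalue_le hβ hT hd hs hl hl1
  have h0 : 0 < 1 / (2 * T : ℝ) := by positivity
  unfold FiniteChain.relaxationTime
  refine ⟨(one_le_inv₀ (h0.trans_le h2)).2 h1, ?_⟩
  have := inv_anti₀ h0 h2
  simpa using this

lemma mixingTime_le (hβ : 0 ≤ β) {d R T : ℕ} (hd : G.maxDegree ≤ d)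
    (hs : ∀ u, ∑ v, sensitivity G β d R T u v ≤ 1) (hV : 2 ≤ Fintype.card V) :
    ((FiniteChain.mixingTime (isolatedVertexDynamics G β) (gibbs G β) : ℕ∞) : ℝ≥0∞) ≤
      ENNReal.ofReal (5 * T / Real.log 2 * Real.log (Fintype.card V)) := by
  set n := Fintype.card V with hn
  have hn2 : (2 : ℝ) ≤ n := by exact_mod_cast hV
  have hl2 : 0 < Real.log 2 := Real.log_pos one_lt_two
  have hln : Real.log 2 ≤ Real.log n := Real.log_le_log two_pos hn2
  -- Chosen so that `2n / 2 ^ k ≤ 1/4`. Rounding up gives at most `4 + log n / log 2`, and `n ≥ 2`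
  -- absorbs the `4` into the constant `5`.
  set k := ⌈Real.log (8 * n) / Real.log 2⌉₊ with hk
  have hk1 : Real.log (8 * n) / Real.log 2 ≤ k := Nat.le_ceil _
  have h8 : Real.log (8 * n) = 3 * Real.log 2 + Real.log n := by
    rw [Real.log_mul (by norm_num) (by linarith), show (8 : ℝ) = 2 ^ 3 by norm_num, Real.log_pow]
    norm_num
  have hk2 : (k : ℝ) ≤ 5 / Real.log 2 * Real.log n := by
    have h := (Nat.ceil_lt_add_one (a := Real.log (8 * n) / Real.log 2)
      (div_nonneg (by rw [h8]; linarith) hl2.le)).le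
    refine h.trans ?_
    rw [h8, div_add_one hl2.ne', div_mul_eq_mul_div, div_le_div_iff_of_pos_right hl2]
    linarith
  have hpow : 8 * (n : ℝ) ≤ 2 ^ k := by
    rw [div_le_iff₀ hl2, ← Real.log_pow] at hk1
    exact (Real.log_le_log_iff (by linarith) (by positivity)).1 hk1
  have hmix : FiniteChain.mixingTime (isolatedVertexDynamics G β) (gibbs G β) ≤
      ((k * T : ℕ) : ℕ∞) := by
    refine iSup_le fun σ => iInf₂_le (k * T) ?_
    refine (tvDist_isolatedVertexDynamics_le hβ (k * T) σ).trans
      ((sum_spinGap_mul_le hβ hd hs k).trans ?_)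
    rw [div_le_iff₀ (by positivity)]
    linarith
  refine (ENat.toENNReal_le.2 hmix).trans ?_
  rw [ENat.toENNReal_coe, ← ENNReal.ofReal_natCast]
  refine ENNReal.ofReal_le_ofReal ?_
  push_cast
  calc (k : ℝ) * T ≤ 5 / Real.log 2 * Real.log n * T :=
        mul_le_mul_of_nonneg_right hk2 (Nat.cast_nonneg T)
    _ = _ := by ring

end Convergence

end Ising

theorem theorem2 (d : ℕ) (β : ℝ) (hβ : 0 < β) (hβc : (β : EReal) < criticalBeta d) :
    ∃ c C : ℝ, 0 < c ∧ 0 < C ∧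
      ∀ (V : Type*) [Fintype V] [DecidableEq V] [Nonempty V]
        (G : SimpleGraph V) [DecidableRel G.Adj], G.maxDegree ≤ d →
        FiniteChain.IsErgodic (Ising.isolatedVertexDynamics G β) ∧
        FiniteChain.IsReversible (Ising.isolatedVertexDynamics G β) (Ising.gibbs G β) ∧
        (2 ≤ Fintype.card V →
          ((FiniteChain.mixingTime (Ising.isolatedVertexDynamics G β) (Ising.gibbs G β) : ℕ∞) :
              ℝ≥0∞) ≤ ENNReal.ofReal (C * Real.log (Fintype.card V))) ∧
        c ≤ FiniteChain.relaxationTime (Ising.isolatedVertexDynamics G β) ∧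
        FiniteChain.relaxationTime (Ising.isolatedVertexDynamics G β) ≤ C := by
  obtain ⟨R, T, hT, hs⟩ := Ising.exists_sum_sensitivity_le_one hβ.le d
    (mul_tanh_lt_one_of_lt_criticalBeta hβ hβc)
  have hl2 : 0 < Real.log 2 := Real.log_pos one_lt_two
  have hT0 : (0 : ℝ) < T := by exact_mod_cast hT
  refine ⟨1, 5 * T / Real.log 2 + 2 * T, one_pos, by positivity, fun V _ _ _ G _ hd => ?_⟩
  obtain ⟨h1, h2⟩ := Ising.relaxationTime_bounds hβ.le hT hd (hs V G hd)
  have h3 : 0 ≤ 5 * T / Real.log 2 := by positivity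
  refine ⟨Ising.isErgodic_isolatedVertexDynamics hβ.le,
    Ising.isReversible_isolatedVertexDynamics, fun hV => ?_, h1, by linarith⟩
  refine (Ising.mixingTime_le hβ.le hd (hs V G hd) hV).trans (ENNReal.ofReal_le_ofReal ?_)
  refine mul_le_mul_of_nonneg_right (by linarith) (Real.log_nonneg ?_)
  exact_mod_cast (one_le_two.trans hV)
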